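/- Notation. A vector bundle on a scheme $Y$ is a locally free $\mathcal O_Y$-module $W$ of finite rank. A torsor under $W$ is a $Y$-scheme $T\to Y$ together with an action of the group functor $(g:S\to Y)\mapsto\Gamma(S,g^*W)$ on the functor of points of $T$ over $Y$, such that for every $g:S\to Y$ the group $\Gamma(S,g^*W)$ acts freely and transitively on the set of $Y$-morphisms $S\to T$ whenever this set is non-empty, and such that $T\to Y$ has sections locally for the fppf topology on $Y$. For a sheaf of modules $M$ on an integral scheme $Z$ with function field $\kappa(Z)$, we write $M_{\kappa(Z)}$ for its stalk at the generic point and $$\Gamma(Z,M)_g:=\{e\in M_{\kappa(Z)}\mid \exists\,\sigma\in\Gamma(Z,M):\ \sigma_{\kappa(Z)}=e\}.$$ A morphism is radicial if it is universally injective, and quasi-finite if it is of finite type with finite fibres. **Lemma 2.1.** Let $Y$ be a normal and integral scheme and let $W$ be a vector bundle over $Y$. Let $T\to Y$ be a torsor under $W$ and let $Z\hookrightarrow T$ be a closed immersion, where $Z$ is an integral scheme. Suppose that the induced morphism $f:Z\to Y$ is dominant, quasi-finite, separated and radicial. Suppose that $\Gamma(Z,\Omega_f\otimes f^*W)_g=0$,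 where $\Omega_f$ is the sheaf of relative differentials of $f$. Then $f$ is an open immersion. -/

import Mathlib

open CategoryTheory AlgebraicGeometry

universe u

noncomputable section

namespace TorsorLemma

/-- A scheme is normal if all of its local rings are integrally closed domains. -/
def IsNormal (Y : Scheme.{u}) : Prop :=
  ∀ y : Y, IsDomain (Y.presheaf.stalk y) ∧ IsIntegrallyClosed (Y.presheaf.stalk y)

/-- The sheaf of modules associated with a presheaf of modules on a scheme. -/
def sheafify {X : Scheme.{u}} (M : X.PresheafOfModules) : X.Modules :=
  (PresheafOfModules.sheafification (𝟙 X.ringCatSheaf.obj)).obj M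

/-- The tensor product of two sheaves of modules on a scheme: the sheaf associated with the
presheaf `U ↦ M(U) ⊗ N(U)`, the tensor product being taken over `𝒪(U)`. -/
def tensor {X : Scheme.{u}} (M N : X.Modules) : X.Modules :=
  sheafify (PresheafOfModules.Monoidal.tensorObj (R := X.presheaf) M.val N.val)

/-- The canonical morphism `f⁻¹ 𝒪_Y ⟶ 𝒪_X` of presheaves of rings on `X`, where `f⁻¹ 𝒪_Y` is the
presheaf inverse image (`U ↦ colim 𝒪_Y(V)` over the opens `V ⊇ f(U)`). It corresponds by
adjunction to `𝒪_Y ⟶ f_* 𝒪_X`. -/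
def inverseImageToStructure {X Y : Scheme.{u}} (f : X ⟶ Y) :
    (TopCat.Presheaf.pullback CommRingCat.{u} f.base).obj Y.presheaf ⟶ X.presheaf :=
  ((TopCat.Presheaf.pullbackPushforwardAdjunction CommRingCat.{u} f.base).homEquiv _ _).symm f.c

/-- The sheaf of relative differentials `Ω_f` of a morphism `f : X ⟶ Y`: the sheaf associated with
`U ↦ Ω_{𝒪_X(U) / (f⁻¹ 𝒪_Y)(U)}`. -/
def differentials {X Y : Scheme.{u}} (f : X ⟶ Y) : X.Modules :=
  sheafify (PresheafOfModules.DifferentialsConstruction.relativeDifferentials'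
    (inverseImageToStructure f))

/-- For `M` a sheaf of modules on an integral scheme `X` with generic point `η`, this is the image
of the group of global sections of `M` in the generic stalk `M_η`. As `𝒪_{X,η}` is the function
field of `X`, the stalk `M_η` is the restriction of `M` to the spectrum of the function field. -/
def genericGlobalSections {X : Scheme.{u}} [IsIntegral X] (M : X.Modules) :
    AddSubgroup (M.presheaf.stalk (genericPoint X)) :=
  (M.presheaf.germ ⊤ (genericPoint X) trivial).hom.range

/-- A vector bundle: a sheaf of modules that is locally free of finite rank. -/
def IsVectorBundle {Y : Scheme.{u}} (W : Y.Modules) : Prop :=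
  ∀ y : Y, ∃ (U : Y.Opens) (_ : y ∈ U) (n : ℕ),
    Nonempty (W.restrict U.ι ≅ SheafOfModules.free.{u} (ULift.{u} (Fin n)))

/-- The pull-back map on global sections `Γ(S, g^* W) ⟶ Γ(S', (g ∘ h)^* W)`, for morphisms
`h : S' ⟶ S` and `g : S ⟶ Y` and a sheaf of modules `W` on `Y`. -/
def pullbackSection {S' S Y : Scheme.{u}} (h : S' ⟶ S) (g : S ⟶ Y) (W : Y.Modules) :
    Γ((Scheme.Modules.pullback g).obj W, ⊤) →+ Γ((Scheme.Modules.pullback (h ≫ g)).obj W, ⊤) :=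
  (((Scheme.Modules.pullbackPushforwardAdjunction h).unit.app
      ((Scheme.Modules.pullback g).obj W)).app ⊤ ≫
    ((Scheme.Modules.pullbackComp h g).hom.app W).app ⊤).hom

/-- The structure of a torsor under the vector bundle `W` on the `Y`-scheme `p : T ⟶ Y`.
The vector bundle `W` is viewed as the group functor `(g : S ⟶ Y) ↦ Γ(S, g^* W)` on `Y`-schemes.
It acts on the functor of points of `T` over `Y`, functorially and simply transitively, and
`T ⟶ Y` has sections locally for the fppf topology. -/
structure Torsor {Y T : Scheme.{u}} (W : Y.Modules) (p : T ⟶ Y) where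
  /-- the action of `Γ(S, g^* W)` on the `Y`-morphisms `S ⟶ T` -/
  act : ∀ {S : Scheme.{u}} (g : S ⟶ Y), Γ((Scheme.Modules.pullback g).obj W, ⊤) →
    {t : S ⟶ T // t ≫ p = g} → {t : S ⟶ T // t ≫ p = g}
  zero_act : ∀ {S : Scheme.{u}} (g : S ⟶ Y) (t : {t : S ⟶ T // t ≫ p = g}), act g 0 t = t
  add_act : ∀ {S : Scheme.{u}} (g : S ⟶ Y) (w w' : Γ((Scheme.Modules.pullback g).obj W, ⊤))
    (t : {t : S ⟶ T // t ≫ p = g}), act g (w + w') t = act g w (act g w' t)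
  act_natural : ∀ {S' S : Scheme.{u}} (h : S' ⟶ S) (g : S ⟶ Y)
    (w : Γ((Scheme.Modules.pullback g).obj W, ⊤)) (t : {t : S ⟶ T // t ≫ p = g}),
    h ≫ (act g w t).1 =
      (act (h ≫ g) (pullbackSection h g W w) ⟨h ≫ t.1, by rw [Category.assoc, t.2]⟩).1
  simply_transitive : ∀ {S : Scheme.{u}} (g : S ⟶ Y) (t t' : {t : S ⟶ T // t ≫ p = g}),
    ∃! w : Γ((Scheme.Modules.pullback g).obj W, ⊤), act g w t = t'
  locally_trivial : ∃ (S : Scheme.{u}) (g : S ⟶ Y), Flat g ∧ Surjective g ∧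
    LocallyOfFinitePresentation g ∧ ∃ t : S ⟶ T, t ≫ p = g

end TorsorLemma

end

/-! Over an affine open `Spec B` of `Z`, let `Ω` be the relative differentials and `B[Ω]` the
trivial square-zero extension. The ring maps `b ↦ b` and `b ↦ b + db` give two points of `Z` with
values in `B[Ω]`. They agree after composition with `f`, since `d` kills functions coming from `Y`.
Their images in `T` therefore lie over one point of `Y` and differ by a unique section of the
pull-back of `W` to `Spec B[Ω]`. This section vanishes modulo `Ω`, so it is a local section of `Ω_f
⊗ f^*W`. By uniqueness of differences these sections glue to a global one (`exists_globalSection`).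

By assumption the global section vanishes at the generic point, hence near it. There the two points
of `T` coincide; as `i` is a monomorphism, so do the two points of `Z`, which means `d = 0`
(`exists_presheafD_eq_zero`). Thus the extension of function fields is unramified
(`formallyUnramified_stalkMap`). It is also purely inseparable, because `f` is radicial, so it is
trivial (`surjective_stalkMap_of_formallyUnramified`). A separated quasi-finite birational morphism
to a normal scheme is an open immersion by Zariski's main theorem
(`isOpenImmersion_of_surjective_stalkMap`). -/

noncomputable section

namespace TorsorLemma

section

/-! ### Function fields, normality and Zariski's main theorem. -/

section Birational

variable {Z Y : Scheme.{u}}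

lemma map_genericPoint [IsIntegral Z] [IsIntegral Y] (f : Z ⟶ Y) [IsDominant f] :
    f (genericPoint Z) = genericPoint Y := by
  have h := (genericPoint_spec Z).image f.continuous
  rw [Set.image_univ, f.denseRange.closure_range] at h
  exact h.eq (genericPoint_spec Y)

lemma isField_stalk_map_genericPoint [IsIntegral Z] [IsIntegral Y] (f : Z ⟶ Y) [IsDominant f] :
    IsField (Y.presheaf.stalk (f (genericPoint Z))) := by
  rw [map_genericPoint]
  exact Field.toIsField Y.functionField

lemma IsNormal.isIntegrallyClosed [IsIntegral Y] (hY : IsNormal Y) {U : Y.Opens}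
    (hU : IsAffineOpen U) [Nonempty U] : IsIntegrallyClosed Γ(Y, U) := by
  refine IsIntegrallyClosed.of_localization_maximal fun p _ _ ↦ ?_
  let x : PrimeSpectrum Γ(Y, U) := ⟨p, inferInstance⟩
  have hx : hU.fromSpec x ∈ U := by
    rw [← SetLike.mem_coe, ← hU.range_fromSpec]; exact ⟨x, rfl⟩
  have h := hU.isLocalization_stalk' x hx
  let := (Y.presheaf.germ U _ hx).hom.toAlgebra
  have : IsLocalization.AtPrime (Y.presheaf.stalk (hU.fromSpec x)) p := h
  have := (hY (hU.fromSpec x)).2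
  exact IsIntegrallyClosed.of_equiv
    (IsLocalization.algEquiv p.primeCompl (Y.presheaf.stalk (hU.fromSpec x))
      (Localization.AtPrime p)).toRingEquiv

lemma isFractionRing_stalk [IsIntegral Y] {U : Y.Opens} (hU : IsAffineOpen U) (y : Y)
    (hy : y = genericPoint Y) (hyU : y ∈ U) :
    letI := (Y.presheaf.germ U y hyU).hom.toAlgebra
    IsFractionRing Γ(Y, U) (Y.presheaf.stalk y) := by
  subst hy
  have : Nonempty U := ⟨⟨_, hyU⟩⟩
  exact functionField_isFractionRing_of_isAffineOpen Y U hU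

/-- An element of `B` integral over `A` lies in `L = K`, the fraction field of `A`, and hence in the
integrally closed ring `A`. -/
lemma bijective_algebraMap_integralClosure {A B L K : Type*} [CommRing A] [CommRing B]
    [CommRing K] [CommRing L] [IsDomain A] [IsIntegrallyClosed A] [Algebra A B] [Algebra A K]
    [IsFractionRing A K] [Algebra B L] [Algebra K L] [Algebra A L] [IsScalarTower A K L]
    [IsScalarTower A B L] (hBL : Function.Injective (algebraMap B L))
    (hKL : Function.Bijective (algebraMap K L)) :
    Function.Bijective (algebraMap A (integralClosure A B)) := by
  constructor
  · intro a b hab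
    have := congr(algebraMap B L (algebraMap (integralClosure A B) B $hab))
    rw [← IsScalarTower.algebraMap_apply A (integralClosure A B) B,
      ← IsScalarTower.algebraMap_apply A (integralClosure A B) B,
      ← IsScalarTower.algebraMap_apply A B L, ← IsScalarTower.algebraMap_apply A B L,
      IsScalarTower.algebraMap_apply A K L, IsScalarTower.algebraMap_apply A K L] at this
    exact IsFractionRing.injective A K (hKL.1 this)
  · rintro ⟨b, hb⟩
    obtain ⟨k, hk⟩ := hKL.2 (algebraMap B L b)
    have hk' : IsIntegral A k := by
      have := hb.map (IsScalarTower.toAlgHom A B L)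
      rw [IsScalarTower.coe_toAlgHom', ← hk] at this
      exact (isIntegral_algHom_iff (IsScalarTower.toAlgHom A K L) hKL.1).mp this
    obtain ⟨a, rfl⟩ := IsIntegrallyClosed.isIntegral_iff.mp hk'
    refine ⟨a, Subtype.ext (hBL ?_)⟩
    rw [← hk, ← IsScalarTower.algebraMap_apply A K L, IsScalarTower.algebraMap_apply A B L]
    rfl

/-- A separated quasi-finite birational morphism to a normal scheme is an open immersion. -/
lemma isOpenImmersion_of_surjective_stalkMap [IsIntegral Z] [IsIntegral Y] (hY : IsNormal Y)
    (f : Z ⟶ Y) [LocallyOfFiniteType f] [QuasiCompact f] [LocallyQuasiFinite f]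
    [IsSeparated f] [IsDominant f]
    (hf : Function.Surjective (f.stalkMap (genericPoint Z))) : IsOpenImmersion f := by
  have hK := isField_stalk_map_genericPoint f
  have hbij : Function.Bijective (f.stalkMap (genericPoint Z)).hom := by
    let := hK.toField
    exact ⟨RingHom.injective _, hf⟩
  -- Zariski's main theorem makes `f.toNormalization` an open immersion, so it remains to see that
  -- the normalization of `Y` in `Z` is `Y` itself.
  suffices IsIso f.fromNormalization by
    rw [← f.toNormalization_fromNormalization]; infer_instance
  change MorphismProperty.isomorphisms Scheme f.fromNormalization
  rw [IsZariskiLocalAtTarget.iff_of_iSup_eq_top (P := .isomorphisms Scheme) _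
    (iSup_affineOpens_eq_top _)]
  rintro ⟨U, hU⟩
  rw [MorphismProperty.isomorphisms.iff]
  rw [isIso_morphismRestrict_iff_isIso_app _ hU]
  rw [f.fromNormalization_app hU]
  let := (f.app U).hom.toAlgebra
  suffices IsIso (CommRingCat.ofHom
      (algebraMap Γ(Y, U) (integralClosure Γ(Y, U) Γ(Z, f ⁻¹ᵁ U)))) by
    infer_instance
  rw [ConcreteCategory.isIso_iff_bijective]
  change Function.Bijective (algebraMap Γ(Y, U) (integralClosure Γ(Y, U) Γ(Z, f ⁻¹ᵁ U)))
  by_cases hUe : Nonempty U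
  · have hηU : f (genericPoint Z) ∈ U := by
      rw [map_genericPoint]
      exact ((genericPoint_spec Y).mem_open_set_iff U.isOpen).mpr (by simpa using hUe)
    have hηZ : genericPoint Z ∈ f ⁻¹ᵁ U := hηU
    have := hY.isIntegrallyClosed hU
    let := (Y.presheaf.germ U _ hηU).hom.toAlgebra
    let := (Z.presheaf.germ (f ⁻¹ᵁ U) _ hηZ).hom.toAlgebra
    let := (f.stalkMap (genericPoint Z)).hom.toAlgebra
    let := (Y.presheaf.germ U _ hηU ≫ f.stalkMap (genericPoint Z)).hom.toAlgebra
    have := isFractionRing_stalk hU _ (map_genericPoint f) hηU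
    have h1 : IsScalarTower Γ(Y, U) (Y.presheaf.stalk (f (genericPoint Z)))
      (Z.presheaf.stalk (genericPoint Z)) := .of_algebraMap_eq' rfl
    have h2 : IsScalarTower Γ(Y, U) Γ(Z, f ⁻¹ᵁ U) (Z.presheaf.stalk (genericPoint Z)) := by
      refine .of_algebraMap_eq' ?_
      exact congr($(f.germ_stalkMap U (genericPoint Z) hηU).hom)
    exact bijective_algebraMap_integralClosure
      (K := Y.presheaf.stalk (f (genericPoint Z))) (L := Z.presheaf.stalk (genericPoint Z))
      (germ_injective_of_isIntegral Z (genericPoint Z) hηZ) hbij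
  · have hU0 : U = ⊥ := by
      ext x; simp only [TopologicalSpace.Opens.coe_bot, Set.mem_empty_iff_false, iff_false]
      exact fun hx ↦ hUe ⟨⟨x, hx⟩⟩
    subst hU0
    have : Subsingleton Γ(Y, ⊥) := inferInstance
    have : Subsingleton Γ(Z, f ⁻¹ᵁ ⊥) := inferInstanceAs (Subsingleton Γ(Z, ⊥))
    exact ⟨fun _ _ _ ↦ Subsingleton.elim _ _, fun b ↦ ⟨0, Subsingleton.elim _ _⟩⟩

/-- Radiciality is a statement about residue fields. This carries it over to the stalks at the
generic points, which are already fields. -/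
lemma isPurelyInseparable_of_comm_sq {F E F' E' : Type*} [Field F] [Field E] [Field F'] [Field E']
    {f : F →+* E} {g : F' →+* E'} (a : F →+* F') (b : E →+* E') (hb : Function.Injective b)
    (ha : Function.Surjective a) (h : g.comp a = b.comp f) (hg : g.IsPurelyInseparable) :
    f.IsPurelyInseparable := by
  algebraize [f, g]
  obtain ⟨q, hq⟩ := ExpChar.exists F
  have hq' : ExpChar F' q := expChar_of_injective_ringHom a.injective q
  rw [RingHom.IsPurelyInseparable, isPurelyInseparable_iff_pow_mem F q]
  intro x
  obtain ⟨n, y, hy⟩ := (isPurelyInseparable_iff_pow_mem F' q).mp ‹_› (b x)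
  obtain ⟨z, rfl⟩ := ha y
  refine ⟨n, z, hb ?_⟩
  rw [map_pow, ← hy]
  exact congr($h z).symm

/-- A radicial morphism of integral schemes of finite type that is generically unramified is
birational onto its image. -/
lemma surjective_stalkMap_of_formallyUnramified [IsIntegral Z] [IsIntegral Y]
    (f : Z ⟶ Y) [LocallyOfFiniteType f] [UniversallyInjective f] [IsDominant f]
    (h : (f.stalkMap (genericPoint Z)).hom.FormallyUnramified) :
    Function.Surjective (f.stalkMap (genericPoint Z)) := by
  have hK := isField_stalk_map_genericPoint f
  let := hK.toField
  let : Field (Z.presheaf.stalk (genericPoint Z)) := inferInstanceAs (Field Z.functionField)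
  have hres := (((tfae_universallyInjective f).out 0 2 :
    UniversallyInjective f ↔ Function.Injective f ∧
      ∀ x, (f.residueFieldMap x).hom.IsPurelyInseparable).mp ‹_›).2 (genericPoint Z)
  have hfin := LocallyOfFiniteType.stalkMap f (genericPoint Z)
  have hpi : (f.stalkMap (genericPoint Z)).hom.IsPurelyInseparable := by
    refine isPurelyInseparable_of_comm_sq (Y.residue _).hom (Z.residue _).hom
      (g := (f.residueFieldMap (genericPoint Z)).hom)
      (RingHom.injective (Z.residue (genericPoint Z)).hom)
      (IsLocalRing.residue_surjective) ?_ hres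
    exact congr($(Scheme.residue_residueFieldMap f (genericPoint Z)).hom)
  algebraize [(f.stalkMap (genericPoint Z)).hom]
  -- An unramified extension of fields essentially of finite type is separable; if it is also purely
  -- inseparable, it is trivial.
  have h3 := Algebra.FormallyUnramified.range_eq_top_of_isPurelyInseparable
    (Y.presheaf.stalk (f (genericPoint Z))) (Z.presheaf.stalk (genericPoint Z))
  intro x
  have : x ∈ (algebraMap (Y.presheaf.stalk (f (genericPoint Z)))
    (Z.presheaf.stalk (genericPoint Z))).range := by rw [h3]; trivial
  exact this

end Birational

end

/-! ### Pull-back of sections, and bases stable under base change. -/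

section

variable {S S' Y : Scheme.{u}}

/-- The pull-back of sections of `W` over `U` to sections of `g^* W` over `V ≤ g ⁻¹ U`. -/
def pullSec (g : S ⟶ Y) (W : Y.Modules) {U : Y.Opens} {V : S.Opens} (h : V ≤ g ⁻¹ᵁ U) :
    Γ(W, U) →+ Γ((Scheme.Modules.pullback g).obj W, V) :=
  (((Scheme.Modules.pullbackPushforwardAdjunction g).unit.app W).app U ≫
    ((Scheme.Modules.pullback g).obj W).presheaf.map (homOfLE h).op).hom

variable (g : S ⟶ Y) (W : Y.Modules) {U U' : Y.Opens} {V V' : S.Opens}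

lemma pullSec_smul (h : V ≤ g ⁻¹ᵁ U) (r : Γ(Y, U)) (x : Γ(W, U)) :
    pullSec g W h (r • x) = g.appLE U V h r • pullSec g W h x := by
  have h1 := Scheme.Modules.Hom.app_smul
    ((Scheme.Modules.pullbackPushforwardAdjunction g).unit.app W) r x
  have h2 := Scheme.Modules.map_smul ((Scheme.Modules.pullback g).obj W) (homOfLE h) (g.app U r)
    (((Scheme.Modules.pullbackPushforwardAdjunction g).unit.app W).app U x)
  exact (congrArg _ h1).trans h2

lemma map_pullSec (h : V ≤ g ⁻¹ᵁ U) (h' : V' ≤ V) (x : Γ(W, U)) :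
    ((Scheme.Modules.pullback g).obj W).presheaf.map (homOfLE h').op (pullSec g W h x) =
      pullSec g W (h'.trans h) x := by
  simp only [pullSec]
  rw [show (homOfLE (h'.trans h)).op = (homOfLE h).op ≫ (homOfLE h').op from rfl,
    Functor.map_comp]
  rfl

lemma pullSec_map (h : V ≤ g ⁻¹ᵁ U') (h' : U' ≤ U) (x : Γ(W, U)) :
    pullSec g W h (W.presheaf.map (homOfLE h').op x) =
      pullSec g W (h.trans (g.preimage_mono h')) x := by
  have h1 := congr($(((Scheme.Modules.pullbackPushforwardAdjunction g).unit.app W).mapPresheaf.naturality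
    (homOfLE h').op) x)
  simp only [pullSec]
  rw [show (homOfLE (h.trans (g.preimage_mono h'))).op =
    (homOfLE (g.preimage_mono h')).op ≫ (homOfLE h).op from rfl,
    Functor.map_comp]
  exact congr(((Scheme.Modules.pullback g).obj W).presheaf.map (homOfLE h).op $h1)

lemma app_pullSec {W W' : Y.Modules} (φ : W ⟶ W') (h : V ≤ g ⁻¹ᵁ U) (x : Γ(W, U)) :
    ((Scheme.Modules.pullback g).map φ).app V (pullSec g W h x) =
      pullSec g W' h (φ.app U x) := by
  have h1 := congr($((Scheme.Modules.pullbackPushforwardAdjunction g).unit.naturality φ).app U x)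
  have h2 := congr($(((Scheme.Modules.pullback g).map φ).mapPresheaf.naturality (homOfLE h).op)
    (((Scheme.Modules.pullbackPushforwardAdjunction g).unit.app W).app U x))
  refine h2.trans ?_
  exact congr(((Scheme.Modules.pullback g).obj W').presheaf.map (homOfLE h).op $h1.symm)

/-- `pullbackComp` corresponds under `conjugateEquiv` to the comparison of direct images, so the
units of the two adjunctions match. -/
lemma pullbackComp_unit (h : S' ⟶ S) (x : Γ(W, U)) :
    ((Scheme.Modules.pullbackComp h g).hom.app W).app (h ⁻¹ᵁ g ⁻¹ᵁ U)
      (((Scheme.Modules.pullbackPushforwardAdjunction h).unit.app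
        ((Scheme.Modules.pullback g).obj W)).app (g ⁻¹ᵁ U)
        (((Scheme.Modules.pullbackPushforwardAdjunction g).unit.app W).app U x)) =
    ((Scheme.Modules.pullbackPushforwardAdjunction (h ≫ g)).unit.app W).app U x := by
  have h2 := unit_conjugateEquiv ((Scheme.Modules.pullbackPushforwardAdjunction g).comp
    (Scheme.Modules.pullbackPushforwardAdjunction h))
    (Scheme.Modules.pullbackPushforwardAdjunction (h ≫ g))
      (Scheme.Modules.pullbackComp h g).inv W
  rw [Scheme.Modules.conjugateEquiv_pullbackComp_inv h g] at h2
  have h3 := congr(($h2).app U x)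
  have h4 := congr(($((Scheme.Modules.pullbackComp h g).inv_hom_id_app W).app (h ⁻¹ᵁ g ⁻¹ᵁ U))
    (((Scheme.Modules.pullbackPushforwardAdjunction (h ≫ g)).unit.app W).app U x))
  exact congr(((Scheme.Modules.pullbackComp h g).hom.app W).app (h ⁻¹ᵁ g ⁻¹ᵁ U) $h3).trans h4

lemma pullbackComp_pullSec (h : S' ⟶ S) {V'' : S'.Opens} (hV : V ≤ g ⁻¹ᵁ U) (hV' : V'' ≤ h ⁻¹ᵁ V)
    (x : Γ(W, U)) :
    ((Scheme.Modules.pullbackComp h g).hom.app W).app V''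
      (pullSec h _ hV' (pullSec g W hV x)) =
        pullSec (h ≫ g) W (hV'.trans (h.preimage_mono hV)) x := by
  have h1 : pullSec h _ hV' (pullSec g W hV x) =
      pullSec h _ (hV'.trans (h.preimage_mono hV))
        (((Scheme.Modules.pullbackPushforwardAdjunction g).unit.app W).app U x) :=
    pullSec_map _ _ _ _ _
  rw [h1]
  have h2 := congr($(((Scheme.Modules.pullbackComp h g).hom.app W).mapPresheaf.naturality
    (homOfLE (hV'.trans (h.preimage_mono hV))).op)
    (((Scheme.Modules.pullbackPushforwardAdjunction h).unit.app
        ((Scheme.Modules.pullback g).obj W)).app (g ⁻¹ᵁ U)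
        (((Scheme.Modules.pullbackPushforwardAdjunction g).unit.app W).app U x)))
  refine h2.trans ?_
  exact congr(((Scheme.Modules.pullback (h ≫ g)).obj W).presheaf.map
    (homOfLE (hV'.trans (h.preimage_mono hV))).op $(pullbackComp_unit g W h x))

/-- Translates the map used in the torsor axioms into `pullSec`, for which the calculus of
restrictions and composites is available. -/
lemma pullbackSection_eq (h : S' ⟶ S) (hT : ⊤ ≤ h ⁻¹ᵁ ⊤)
    (x : Γ((Scheme.Modules.pullback g).obj W, ⊤)) :
    pullbackSection h g W x = ((Scheme.Modules.pullbackComp h g).hom.app W).app ⊤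
      (pullSec h _ hT x) := by
  have : pullSec h _ hT x =
    ((Scheme.Modules.pullbackPushforwardAdjunction h).unit.app _).app ⊤ x :=
    congr($(((Scheme.Modules.pullback h).obj _).presheaf.map_id _) _)
  rw [this]
  rfl

lemma pullbackSection_pullSec (h : S' ⟶ S) (hU : ⊤ ≤ g ⁻¹ᵁ U) (hU' : ⊤ ≤ (h ≫ g) ⁻¹ᵁ U)
    (x : Γ(W, U)) :
    pullbackSection h g W (pullSec g W hU x) = pullSec (h ≫ g) W hU' x := by
  rw [pullbackSection_eq g W h (by simp)]
  exact pullbackComp_pullSec g W h hU _ x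

lemma pullbackSection_smul (h : S' ⟶ S) (r : Γ(S, ⊤))
    (x : Γ((Scheme.Modules.pullback g).obj W, ⊤)) :
    pullbackSection h g W (r • x) = h.appTop r • pullbackSection h g W x := by
  have hT : ⊤ ≤ h ⁻¹ᵁ ⊤ := by simp
  rw [pullbackSection_eq g W h hT, pullbackSection_eq g W h hT, pullSec_smul h _ hT]
  refine (Scheme.Modules.Hom.app_smul _ _ _).trans ?_
  congr 2
  rw [Scheme.Hom.appTop, Scheme.Hom.app_eq_appLE]
  rfl

/-- A family of sections of `M` over `V` which is a basis of the sections of `M` over `V`. -/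
def IsBasis {n : ℕ} {M : S.Modules} (e : Fin n → Γ(M, V)) : Prop :=
  Function.Bijective fun c : Fin n → Γ(S, V) ↦ ∑ i, c i • e i

lemma isBasis_iff_of_bijective {n : ℕ} {M : S.Modules} {M' : S'.Modules} {V' : S'.Opens}
    {e : Fin n → Γ(M, V)} {e' : Fin n → Γ(M', V')} (σ : Γ(S, V) →+* Γ(S', V'))
    (φ : Γ(M, V) →+ Γ(M', V')) (hσ : Function.Bijective σ) (hφ : Function.Bijective φ)
    (h : ∀ r x, φ (r • x) = σ r • φ x) (he : ∀ i, φ (e i) = e' i) : IsBasis e ↔ IsBasis e' := by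
  have h1 : (fun c : Fin n → Γ(S', V') ↦ ∑ i, c i • e' i) ∘ (fun c i ↦ σ (c i)) =
      φ ∘ (fun c : Fin n → Γ(S, V) ↦ ∑ i, c i • e i) := by
    ext c
    simp [h, he]
  have h2 : Function.Bijective (fun (c : Fin n → Γ(S, V)) i ↦ σ (c i)) :=
    (Equiv.piCongrRight fun _ : Fin n ↦ Equiv.ofBijective σ hσ).bijective
  rw [IsBasis, IsBasis, ← hφ.of_comp_iff', ← h1, h2.of_comp_iff]

lemma isIso_map_homOfLE {C : Type*} [Category C] (F : (S.Opens)ᵒᵖ ⥤ C) (h : V ≤ V') (e : V = V') :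
    IsIso (F.map (homOfLE h).op) := by
  subst e
  rw [show (homOfLE h).op = 𝟙 _ from rfl]
  infer_instance

/-- For an open immersion the pull-back is the restriction, and the unit becomes a restriction map
between equal opens. -/
lemma bijective_pullSec_opensι (V : S.Opens) (M : S.Modules) (h : ⊤ ≤ V.ι ⁻¹ᵁ V) :
    Function.Bijective (pullSec V.ι M h) := by
  have h1 := (Scheme.Modules.restrictAdjunction V.ι).unit_leftAdjointUniq_hom_app
    (Scheme.Modules.pullbackPushforwardAdjunction V.ι) M
  have h2 : ((Scheme.Modules.pullbackPushforwardAdjunction V.ι).unit.app M).app V =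
    M.presheaf.map (homOfLE (V.ι.image_preimage_le V)).op ≫
      ((Scheme.Modules.restrictFunctorIsoPullback V.ι).hom.app M).app (V.ι ⁻¹ᵁ V) :=
    congr(($h1).app V).symm
  have h3 := isIso_map_homOfLE M.presheaf (V.ι.image_preimage_le V) (by simp)
  have h4 := isIso_map_homOfLE ((Scheme.Modules.pullback V.ι).obj M).presheaf h (by simp)
  change Function.Bijective (_ ≫ _ : Γ(M, V) ⟶ Γ((Scheme.Modules.pullback V.ι).obj M, ⊤)).hom
  rw [h2]
  have h5 : IsIso (((Scheme.Modules.restrictFunctorIsoPullback V.ι).hom.app M).app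
    (V.ι ⁻¹ᵁ V)) := Scheme.Modules.Hom.isIso_iff_isIso_app.mp inferInstance _
  have h6 := @IsIso.comp_isIso _ _ _ _ _ _ _ (@IsIso.comp_isIso _ _ _ _ _ _ _ h3 h5) h4
  exact @ConcreteCategory.bijective_of_isIso _ _ _ _ _ _ _ _ _ h6

/-- `e` is a basis of `W` over `U` that remains a basis after every base change. -/
def IsFrame {n : ℕ} {W : Y.Modules} {U : Y.Opens} (e : Fin n → Γ(W, U)) : Prop :=
  ∀ (S : Scheme.{u}) (g : S ⟶ Y) (V : S.Opens) (h : V ≤ g ⁻¹ᵁ U),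
    IsBasis fun i ↦ pullSec g W h (e i)

lemma isBasis_pullSec_comp_iff (h : S' ⟶ S) {n : ℕ} {V'' : S'.Opens} (hV : V ≤ g ⁻¹ᵁ U)
    (hV' : V'' ≤ h ⁻¹ᵁ V) (e : Fin n → Γ(W, U)) :
    IsBasis (fun i ↦ pullSec h _ hV' (pullSec g W hV (e i))) ↔
      IsBasis (fun i ↦ pullSec (h ≫ g) W (hV'.trans (h.preimage_mono hV)) (e i)) := by
  refine isBasis_iff_of_bijective (RingHom.id _)
    (((Scheme.Modules.pullbackComp h g).hom.app W).app V'').hom Function.bijective_id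
    ?_ (fun r x ↦ Scheme.Modules.Hom.app_smul _ _ _) fun i ↦ pullbackComp_pullSec _ _ _ _ _ _
  have : IsIso (((Scheme.Modules.pullbackComp h g).hom.app W).app V'') :=
    Scheme.Modules.Hom.isIso_iff_isIso_app.mp inferInstance _
  exact ConcreteCategory.bijective_of_isIso (((Scheme.Modules.pullbackComp h g).hom.app W).app V'')

lemma isBasis_pullSec_opensι_iff (V : S.Opens) {M : S.Modules} (h : ⊤ ≤ V.ι ⁻¹ᵁ V) {n : ℕ}
    (e : Fin n → Γ(M, V)) : IsBasis e ↔ IsBasis (fun i ↦ pullSec V.ι M h (e i)) := by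
  refine isBasis_iff_of_bijective (V.ι.appLE V ⊤ h).hom _ ?_ (bijective_pullSec_opensι V M h)
    (fun r x ↦ pullSec_smul _ _ _ _ _) fun i ↦ rfl
  have : IsIso (V.ι.appLE V ⊤ h) := by
    rw [Scheme.Opens.ι_appLE]
    exact isIso_map_homOfLE _ _ (by simp)
  exact ConcreteCategory.bijective_of_isIso (V.ι.appLE V ⊤ h)

/-- Any `V ≤ g ⁻¹ᵁ U` maps to `Y` through the scheme `U`, so global sections over schemes above `U`
suffice. -/
lemma isFrame_of_pullback_opensι (U : Y.Opens) (hU : ⊤ ≤ U.ι ⁻¹ᵁ U) {n : ℕ} (e : Fin n → Γ(W, U))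
    (he : ∀ (S : Scheme.{u}) (g : S ⟶ U),
      IsBasis fun i ↦ pullSec g _ (show ⊤ ≤ g ⁻¹ᵁ ⊤ by simp) (pullSec U.ι W hU (e i))) :
    IsFrame e := by
  intro S g V h
  have hV : ⊤ ≤ V.ι ⁻¹ᵁ V := by simp
  rw [isBasis_pullSec_opensι_iff V hV, isBasis_pullSec_comp_iff]
  -- The morphism is generalized to a variable `k` because the type of the pulled-back sections
  -- depends on it.
  have h1 : ∀ (k : (V : Scheme.{u}) ⟶ Y) (hk : k = g.resLE U V h ≫ U.ι) (hU : ⊤ ≤ k ⁻¹ᵁ U),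
    IsBasis (fun i ↦ pullSec k W hU (e i)) := by
    rintro k rfl hU'
    exact (isBasis_pullSec_comp_iff U.ι W (g.resLE U V h) hU _ e).mp (he _ _)
  exact h1 _ (by simp) _

lemma isFrame_map {n : ℕ} {e : Fin n → Γ(W, U)} (he : IsFrame e) (h : U' ≤ U) :
    IsFrame fun i ↦ W.presheaf.map (homOfLE h).op (e i) := by
  intro S g V hV
  simp only [pullSec_map]
  exact he S g V _

end

/-! ### Frames of vector bundles, from decompositions into copies of the structure sheaf. -/

section

variable {S S' Y X : Scheme.{u}}

/-- The structure sheaf as a module over itself. -/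
def unitModule (X : Scheme.{u}) : X.Modules := SheafOfModules.unit X.ringCatSheaf

/-- The section `1` of the structure sheaf. -/
def unitSection (X : Scheme.{u}) (V : X.Opens) : Γ(unitModule X, V) := (1 : Γ(X, V))

lemma smul_unitSection {V : X.Opens} (r : Γ(X, V)) :
    (r • unitSection X V : Γ(unitModule X, V)) = r := mul_one r

lemma smul_unitSection' {V : X.Opens} (x : Γ(unitModule X, V)) :
    (show Γ(X, V) from x) • unitSection X V = x := mul_one (show Γ(X, V) from x)

lemma sum_app {n : ℕ} {M N : X.Modules} (φ : Fin n → (M ⟶ N)) (V : X.Opens) (x : Γ(M, V)) :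
    (∑ i, φ i).app V x = ∑ i, (φ i).app V x :=
  map_sum (AddMonoidHom.mk' (fun φ : M ⟶ N ↦ φ.app V x) fun _ _ ↦ rfl) φ Finset.univ

/-- The maps `π j` read off the coordinates. The hypotheses are equations between morphisms so that
additive functors preserve them. -/
lemma isBasis_of_unit {n : ℕ} {M : X.Modules} (u : Fin n → (unitModule X ⟶ M))
    (π : Fin n → (M ⟶ unitModule X)) (h1 : ∀ i j, u i ≫ π j = if i = j then 𝟙 _ else 0)
    (h2 : ∑ i, π i ≫ u i = 𝟙 M) (V : X.Opens) :
    IsBasis fun i ↦ (u i).app V (unitSection X V) := by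
  have h3 (c : Fin n → Γ(X, V)) (j : Fin n) :
      (π j).app V (∑ i, c i • (u i).app V (unitSection X V)) = c j := by
    rw [map_sum, Finset.sum_eq_single j]
    · rw [Scheme.Modules.Hom.app_smul]
      have := congr(($(h1 j j)).app V (unitSection X V))
      rw [if_pos rfl] at this
      exact (congr(c j • $this)).trans (smul_unitSection (c j))
    · intro i _ hij
      rw [Scheme.Modules.Hom.app_smul]
      have := congr(($(h1 i j)).app V (unitSection X V))
      rw [if_neg hij] at this
      rw [show (π j).app V ((u i).app V (unitSection X V)) = 0 from this, smul_zero]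
    · simp
  constructor
  · intro c c' h
    ext j
    rw [← h3 c j, ← h3 c' j]
    exact congr((π j).app V $h)
  · intro x
    refine ⟨fun i ↦ (π i).app V x, ?_⟩
    have h4 := congr(($h2).app V x)
    rw [sum_app] at h4
    refine Eq.trans ?_ h4
    refine Finset.sum_congr rfl fun i _ ↦ ?_
    refine (Scheme.Modules.Hom.app_smul (u i) ((π i).app V x) (unitSection X V)).symm.trans ?_
    exact congr((u i).app V $(smul_unitSection' ((π i).app V x)))

/-- Finality is what makes the pull-back of the structure sheaf the structure sheaf. -/
lemma final_opensMap (g : S ⟶ X) : (TopologicalSpace.Opens.map g.base).Final :=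
  Functor.final_of_exists_of_isFiltered _ (fun _ ↦ ⟨⊤, ⟨homOfLE le_top⟩⟩)
    fun {_ c} _ _ ↦ ⟨c, 𝟙 _, Subsingleton.elim _ _⟩

/-- The canonical morphism from the structure sheaf to the direct image of the structure sheaf. -/
def unitToPushforward (g : S ⟶ X) :
    unitModule X ⟶ (Scheme.Modules.pushforward g).obj (unitModule S) :=
  SheafOfModules.unitToPushforwardObjUnit g.toRingCatSheafHom

lemma unitToPushforward_app (g : S ⟶ X) (U : X.Opens) :
    (unitToPushforward g).app U (unitSection X U) = unitSection S (g ⁻¹ᵁ U) :=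
  (g.app U).hom.map_one

/-- The canonical morphism from the pull-back of the structure sheaf to the structure sheaf. -/
def pullbackUnitHom (g : S ⟶ X) :
    (Scheme.Modules.pullback g).obj (unitModule X) ⟶ unitModule S :=
  ((Scheme.Modules.pullbackPushforwardAdjunction g).homEquiv _ _).symm (unitToPushforward g)

instance (g : S ⟶ X) : IsIso (pullbackUnitHom g) := by
  have : (SheafOfModules.pushforward.{u} g.toRingCatSheafHom).IsRightAdjoint :=
    (Scheme.Modules.pullbackPushforwardAdjunction g).isRightAdjoint
  have := final_opensMap g
  exact SheafOfModules.instIsIsoPullbackObjUnitToUnitOfFinal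
    (F := TopologicalSpace.Opens.map g.base) g.toRingCatSheafHom

/-- The pull-back of the structure sheaf is the structure sheaf. -/
def pullbackUnitIso (g : S ⟶ X) :
    (Scheme.Modules.pullback g).obj (unitModule X) ≅ unitModule S :=
  asIso (pullbackUnitHom g)

lemma pullbackUnitIso_pullSec (g : S ⟶ X) {V : S.Opens} {U : X.Opens} (h : V ≤ g ⁻¹ᵁ U) :
    (pullbackUnitIso g).hom.app V (pullSec g _ h (unitSection X U)) = unitSection S V := by
  have h1 : (Scheme.Modules.pullbackPushforwardAdjunction g).homEquiv _ _
      (pullbackUnitHom g) = unitToPushforward g := Equiv.apply_symm_apply _ _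
  rw [Adjunction.homEquiv_unit] at h1
  have h2 := congr(($h1).app U (unitSection X U))
  rw [unitToPushforward_app] at h2
  have h3 := congr($((pullbackUnitHom g).mapPresheaf.naturality (homOfLE h).op)
    (((Scheme.Modules.pullbackPushforwardAdjunction g).unit.app _).app U (unitSection X U)))
  refine h3.trans ?_
  refine congr((unitModule S).presheaf.map (homOfLE h).op $h2).trans ?_
  exact (S.presheaf.map (homOfLE h).op).hom.map_one

/-- Pull-back is additive and preserves the structure sheaf, so it carries the decomposition of `M`
to one of the same shape. -/
lemma isBasis_pullSec_of_unit {n : ℕ} {M : X.Modules} (u : Fin n → (unitModule X ⟶ M))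
    (π : Fin n → (M ⟶ unitModule X)) (h1 : ∀ i j, u i ≫ π j = if i = j then 𝟙 _ else 0)
    (h2 : ∑ i, π i ≫ u i = 𝟙 M) (g : S ⟶ X) {V : S.Opens} {U : X.Opens} (h : V ≤ g ⁻¹ᵁ U) :
    IsBasis fun i ↦ pullSec g M h ((u i).app U (unitSection X U)) := by
  have := isBasis_of_unit (fun i ↦ (pullbackUnitIso g).inv ≫ (Scheme.Modules.pullback g).map (u i))
    (fun i ↦ (Scheme.Modules.pullback g).map (π i) ≫ (pullbackUnitIso g).hom) ?_ ?_ V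
  · convert this using 2 with i
    rw [← app_pullSec, ← pullbackUnitIso_pullSec g h]
    have h4 := congr(($((pullbackUnitIso g).hom_inv_id)).app V (pullSec g _ h (unitSection X U)))
    exact congr(((Scheme.Modules.pullback g).map (u i)).app V $h4).symm
  · intro i j
    have := congr((Scheme.Modules.pullback g).map $(h1 i j))
    simp only [Functor.map_comp] at this
    simp only [Category.assoc, reassoc_of% this]
    split_ifs <;> simp
  · have := congr((Scheme.Modules.pullback g).map $(h2))
    simpa [Functor.map_sum] using this

/-- The free module with basis `ι`. -/
def freeModule (X : Scheme.{u}) (ι : Type u) : X.Modules := SheafOfModules.free.{u} ι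

/-- The inclusion of a summand of a free module. -/
def freeModuleι (X : Scheme.{u}) {ι : Type u} (i : ι) : unitModule X ⟶ freeModule X ι :=
  SheafOfModules.ιFree i

open Classical in
/-- The projection of a free module on a summand. -/
def freeModuleπ (X : Scheme.{u}) {ι : Type u} (j : ι) : freeModule X ι ⟶ unitModule X :=
  Limits.Cofan.IsColimit.desc (SheafOfModules.isColimitFreeCofan ι)
    fun i ↦ (if i = j then 𝟙 (unitModule X) else 0 : unitModule X ⟶ unitModule X)

open Classical in
lemma freeModuleι_π {ι : Type u} (i j : ι) :
    freeModuleι X i ≫ freeModuleπ X j = if i = j then 𝟙 _ else 0 :=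
  Limits.Cofan.IsColimit.fac (SheafOfModules.isColimitFreeCofan ι) _ i

lemma freeModule_hom_ext {ι : Type u} {M : X.Modules} {φ ψ : freeModule X ι ⟶ M}
    (h : ∀ i, freeModuleι X i ≫ φ = freeModuleι X i ≫ ψ) : φ = ψ :=
  Limits.Cofan.IsColimit.hom_ext (SheafOfModules.isColimitFreeCofan ι) _ _ h

lemma sum_freeModuleπ_ι {ι : Type u} [Fintype ι] :
    ∑ i, freeModuleπ X i ≫ freeModuleι X i = 𝟙 (freeModule X ι) := by
  classical
  refine freeModule_hom_ext fun i ↦ ?_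
  simp only [Preadditive.comp_sum, reassoc_of% freeModuleι_π]
  rw [Finset.sum_eq_single i (fun j _ hj ↦ by rw [if_neg hj.symm, Limits.zero_comp]) (by simp),
    if_pos rfl, Category.id_comp, Category.comp_id]

lemma exists_isFrame_of_iso (U : Y.Opens) (W : Y.Modules) (n : ℕ)
    (α : W.restrict U.ι ≅ freeModule U (ULift.{u} (Fin n))) :
    ∃ e : Fin n → Γ(W, U), IsFrame e := by
  have hU : ⊤ ≤ U.ι ⁻¹ᵁ U := by simp
  let β := ((Scheme.Modules.restrictFunctorIsoPullback U.ι).app W).symm ≪≫ α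
  let u (i : Fin n) := freeModuleι U (ULift.up.{u} i) ≫ β.inv
  let π (i : Fin n) := β.hom ≫ freeModuleπ U (ULift.up.{u} i)
  choose e he using fun i ↦ (bijective_pullSec_opensι U W hU).2 ((u i).app ⊤ (unitSection U ⊤))
  refine ⟨e, isFrame_of_pullback_opensι W U hU e fun S g ↦ ?_⟩
  simp only [he]
  refine isBasis_pullSec_of_unit u π (fun i j ↦ ?_) ?_ g _
  · simp [u, π, freeModuleι_π]
  · have := congr(β.hom ≫ $(sum_freeModuleπ_ι (X := U) (ι := ULift.{u} (Fin n))) ≫ β.inv)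
    rw [Category.id_comp, Iso.hom_inv_id, Preadditive.sum_comp, Preadditive.comp_sum] at this
    rw [← this, ← Equiv.ulift.symm.sum_comp]
    simp [u, π]

lemma IsVectorBundle.exists_isFrame {W : Y.Modules} (hW : IsVectorBundle W) (y : Y) :
    ∃ (U : Y.Opens) (_ : y ∈ U) (n : ℕ) (e : Fin n → Γ(W, U)), IsAffineOpen U ∧ IsFrame e := by
  obtain ⟨U, hyU, n, ⟨α⟩⟩ := hW y
  obtain ⟨e, he⟩ := exists_isFrame_of_iso U W n α
  obtain ⟨_, ⟨U', hU', rfl⟩, hyU', hUU' : U' ≤ U⟩ :=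
    Y.isBasis_affineOpens.exists_subset_of_mem_open hyU U.2
  exact ⟨U', hyU', n, _, hU', isFrame_map W he hUU'⟩

end

/-! ### Trivial square-zero extensions and derivations. -/

section SqZero

variable (B : Type u) (M : Type u) [CommRing B] [AddCommGroup M] [Module B M]

/-- The trivial square-zero extension of `B` by `M`. -/
def SqZeroExt : Type u := TrivSqZeroExt B M

namespace SqZeroExt

instance : CommRing (SqZeroExt B M) :=
  -- As `B` is commutative, the left action also serves as the right action that the ring structure
  -- on `TrivSqZeroExt` requires.
  let _ : Module Bᵐᵒᵖ M := Module.compHom M ((RingHom.id B).fromOpposite fun _ _ ↦ mul_comm _ _)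
  have : IsCentralScalar B M := ⟨fun _ _ ↦ rfl⟩
  inferInstanceAs (CommRing (TrivSqZeroExt B M))

variable {B M}

/-- The element `b + m`. -/
def mk (b : B) (m : M) : SqZeroExt B M := (b, m)

/-- The projection to `B`. -/
def fst : SqZeroExt B M →+* B where
  toFun x := Prod.fst x
  map_one' := rfl
  map_mul' _ _ := rfl
  map_zero' := rfl
  map_add' _ _ := rfl

/-- The projection to `M`. -/
def snd : SqZeroExt B M →+ M where
  toFun x := Prod.snd x
  map_zero' := rfl
  map_add' _ _ := rfl

lemma snd_mul (x y : SqZeroExt B M) : snd (x * y) = fst x • snd y + fst y • snd x := rfl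

lemma snd_one : snd (1 : SqZeroExt B M) = 0 := rfl

@[simp] lemma fst_mk (b : B) (m : M) : fst (mk b m) = b := rfl

@[simp] lemma snd_mk (b : B) (m : M) : snd (mk b m) = m := rfl

lemma ext {x y : SqZeroExt B M} (h : fst x = fst y) (h' : snd x = snd y) : x = y :=
  Prod.ext h h'

/-- The ring homomorphism `b ↦ b + d b` defined by a derivation `d`. -/
def ofDerivation (d : Derivation ℤ B M) : B →+* SqZeroExt B M where
  toFun b := mk b (d b)
  map_one' := ext (by simp) (by simp [snd_one])
  map_mul' _ _ := ext (by simp) (by simp [snd_mul])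
  map_zero' := ext (by simp) (by simp)
  map_add' _ _ := ext (by simp) (by simp)

@[simp] lemma fst_ofDerivation (d : Derivation ℤ B M) (b : B) : fst (ofDerivation d b) = b := rfl

@[simp] lemma snd_ofDerivation (d : Derivation ℤ B M) (b : B) : snd (ofDerivation d b) = d b := rfl

lemma fst_comp_ofDerivation (d : Derivation ℤ B M) : fst.comp (ofDerivation d) = RingHom.id B := rfl

variable {B' M' : Type u} [CommRing B'] [AddCommGroup M'] [Module B' M']

/-- The functoriality of the square-zero extension. -/
def map (r : B →+* B') (m : M →+ M') (h : ∀ b x, m (b • x) = r b • m x) :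
    SqZeroExt B M →+* SqZeroExt B' M' where
  toFun x := mk (r (fst x)) (m (snd x))
  map_one' := ext (by simp) (by simp [snd_one])
  map_mul' _ _ := ext (by simp) (by simp [snd_mul, h])
  map_zero' := ext (by simp) (by simp)
  map_add' _ _ := ext (by simp) (by simp)

lemma map_comp_ofDerivation (r : B →+* B') (m : M →+ M') (h : ∀ b x, m (b • x) = r b • m x)
    (d : Derivation ℤ B M) (d' : Derivation ℤ B' M') (hd : ∀ b, m (d b) = d' (r b)) :
    (map r m h).comp (ofDerivation d) = (ofDerivation d').comp r :=
  RingHom.ext fun b ↦ ext rfl (hd b)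

end SqZeroExt

end SqZero

/-! ### Differences of points of a torsor, and coordinates in a basis. -/

section Torsor

variable {S S' Y T Z : Scheme.{u}} {W : Y.Modules} {p : T ⟶ Y} (τ : Torsor W p)

/-- The difference of two points of a torsor. -/
def Torsor.diff (g : S ⟶ Y) (t t' : {t : S ⟶ T // t ≫ p = g}) :
    Γ((Scheme.Modules.pullback g).obj W, ⊤) :=
  (τ.simply_transitive g t t').choose

lemma Torsor.act_diff (g : S ⟶ Y) (t t' : {t : S ⟶ T // t ≫ p = g}) :
    τ.act g (τ.diff g t t') t = t' :=
  (τ.simply_transitive g t t').choose_spec.1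

lemma Torsor.eq_diff (g : S ⟶ Y) {t t' : {t : S ⟶ T // t ≫ p = g}}
    {w : Γ((Scheme.Modules.pullback g).obj W, ⊤)} (h : τ.act g w t = t') : w = τ.diff g t t' :=
  (τ.simply_transitive g t t').choose_spec.2 w h

lemma Torsor.diff_self (g : S ⟶ Y) (t : {t : S ⟶ T // t ≫ p = g}) : τ.diff g t t = 0 :=
  (τ.eq_diff g (τ.zero_act g t)).symm

lemma Torsor.eq_of_diff_eq_zero (g : S ⟶ Y) {t t' : {t : S ⟶ T // t ≫ p = g}}
    (h : τ.diff g t t' = 0) : t = t' := by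
  rw [← τ.act_diff g t t', h, τ.zero_act]

lemma Torsor.pullbackSection_diff (h : S' ⟶ S) (g : S ⟶ Y) (t t' : {t : S ⟶ T // t ≫ p = g}) :
    pullbackSection h g W (τ.diff g t t') =
      τ.diff (h ≫ g) ⟨h ≫ t.1, by rw [Category.assoc, t.2]⟩
        ⟨h ≫ t'.1, by rw [Category.assoc, t'.2]⟩ := by
  refine τ.eq_diff _ (Subtype.ext ?_)
  rw [← τ.act_natural, τ.act_diff]

end Torsor

section Coord

variable {S : Scheme.{u}} {M : S.Modules} {V : S.Opens} {n : ℕ} {e : Fin n → Γ(M, V)}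

/-- The coordinates of a section with respect to a basis. -/
def IsBasis.coord (he : IsBasis e) (x : Γ(M, V)) : Fin n → Γ(S, V) :=
  (he.2 x).choose

lemma IsBasis.sum_coord (he : IsBasis e) (x : Γ(M, V)) : ∑ j, he.coord x j • e j = x :=
  (he.2 x).choose_spec

lemma IsBasis.coord_eq (he : IsBasis e) {x : Γ(M, V)} {c : Fin n → Γ(S, V)}
    (h : ∑ j, c j • e j = x) : he.coord x = c :=
  he.1 ((he.sum_coord x).trans h.symm)

lemma IsBasis.coord_zero (he : IsBasis e) : he.coord 0 = 0 :=
  he.coord_eq (by simp)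

end Coord

/-! ### The two points attached to a derivation, and the coordinates of their difference. -/

section

variable {Y T Z : Scheme.{u}} {f : Z ⟶ Y} {V V' : Z.Opens} (hV : IsAffineOpen V)
  (hV' : IsAffineOpen V') {M M' : Type u}
  [AddCommGroup M] [Module Γ(Z, V) M] [AddCommGroup M'] [Module Γ(Z, V') M']

/-- The point of `Z` with values in a square-zero extension defined by a derivation. -/
def derivationPoint (d : Derivation ℤ Γ(Z, V) M) :
    Spec (.of (SqZeroExt Γ(Z, V) M)) ⟶ Z :=
  Spec.map (CommRingCat.ofHom (SqZeroExt.ofDerivation d)) ≫ hV.fromSpec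

lemma derivationPoint_comp {U : Y.Opens} (hU : IsAffineOpen U) (h : V ≤ f ⁻¹ᵁ U)
    (d : Derivation ℤ Γ(Z, V) M) (hd : ∀ r, d (f.appLE U V h r) = 0) :
    derivationPoint hV d ≫ f = derivationPoint hV (0 : Derivation ℤ Γ(Z, V) M) ≫ f := by
  simp only [derivationPoint, Category.assoc]
  rw [← IsAffineOpen.SpecMap_appLE_fromSpec f hU hV h, ← Spec.map_comp_assoc,
    ← Spec.map_comp_assoc]
  congr 2
  ext r
  exact SqZeroExt.ext rfl (hd r)

lemma fst_comp_derivationPoint (d : Derivation ℤ Γ(Z, V) M) :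
    Spec.map (CommRingCat.ofHom SqZeroExt.fst) ≫ derivationPoint hV d = hV.fromSpec := by
  rw [derivationPoint, ← Spec.map_comp_assoc, ← CommRingCat.ofHom_comp,
    SqZeroExt.fst_comp_ofDerivation]
  exact (congr(Spec.map $(CommRingCat.ofHom_id) ≫ _)).trans (by simp)

lemma le_derivationPoint_comp_preimage {U : Y.Opens} (h : V ≤ f ⁻¹ᵁ U)
    (d : Derivation ℤ Γ(Z, V) M) : ⊤ ≤ (derivationPoint hV d ≫ f) ⁻¹ᵁ U := by
  rw [Scheme.Hom.comp_preimage, derivationPoint, Scheme.Hom.comp_preimage]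
  intro x _
  apply h
  exact hV.range_fromSpec.subset ⟨_, rfl⟩

/-- `hV.fromSpec` is a monomorphism, and the `M`-component of the ring map is the derivation. -/
lemma derivationPoint_injective {d d' : Derivation ℤ Γ(Z, V) M}
    (h : derivationPoint hV d = derivationPoint hV d') : d = d' := by
  rw [derivationPoint, derivationPoint, cancel_mono] at h
  ext b
  exact congr(SqZeroExt.snd ($(Spec.map_injective h) b))

/-- The morphism of spectra of square-zero extensions defined by a restriction map. -/
def sqZeroRestrict (h : V' ≤ V) (m : M →+ M')
    (hm : ∀ b x, m (b • x) = (Z.presheaf.map (homOfLE h).op).hom b • m x) :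
    Spec (.of (SqZeroExt Γ(Z, V') M')) ⟶ Spec (.of (SqZeroExt Γ(Z, V) M)) :=
  Spec.map (CommRingCat.ofHom (SqZeroExt.map _ m hm))

lemma sqZeroRestrict_comp (h : V' ≤ V) (m : M →+ M')
    (hm : ∀ b x, m (b • x) = (Z.presheaf.map (homOfLE h).op).hom b • m x)
    (d : Derivation ℤ Γ(Z, V) M) (d' : Derivation ℤ Γ(Z, V') M')
    (hd : ∀ b, m (d b) = d' ((Z.presheaf.map (homOfLE h).op).hom b)) :
    sqZeroRestrict h m hm ≫ derivationPoint hV d = derivationPoint hV' d' := by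
  rw [derivationPoint, derivationPoint, ← hV.map_fromSpec hV' (homOfLE h).op, sqZeroRestrict,
    ← Spec.map_comp_assoc, ← Spec.map_comp_assoc, ← CommRingCat.ofHom_comp,
    SqZeroExt.map_comp_ofDerivation _ _ _ _ _ hd]
  rfl

variable {W : Y.Modules} {p : T ⟶ Y} (τ : Torsor W p) {i : Z ⟶ T} (hf : i ≫ p = f)

/-- The difference of the points defined by a derivation `d` and by the derivation `0`. -/
def derivationDiff {d : Derivation ℤ Γ(Z, V) M}
    (hd : derivationPoint hV d ≫ f = derivationPoint hV (0 : Derivation ℤ Γ(Z, V) M) ≫ f) :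
    Γ((Scheme.Modules.pullback (derivationPoint hV (0 : Derivation ℤ Γ(Z, V) M) ≫ f)).obj W, ⊤) :=
  τ.diff _ ⟨derivationPoint hV 0 ≫ i, by rw [Category.assoc, hf]⟩
    ⟨derivationPoint hV d ≫ i, by rw [Category.assoc, hf, hd]⟩

variable {U : Y.Opens} {n : ℕ} {e : Fin n → Γ(W, U)} (he : IsFrame e) (hVU : V ≤ f ⁻¹ᵁ U)

/-- The coordinates of `derivationDiff` with respect to a frame. -/
def diffCoord {d : Derivation ℤ Γ(Z, V) M}
    (hd : derivationPoint hV d ≫ f = derivationPoint hV (0 : Derivation ℤ Γ(Z, V) M) ≫ f)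
    (j : Fin n) : SqZeroExt Γ(Z, V) M :=
  (Scheme.ΓSpecIso (.of (SqZeroExt Γ(Z, V) M))).hom.hom
    ((he _ _ ⊤ (le_derivationPoint_comp_preimage hV hVU 0)).coord (derivationDiff hV τ hf hd) j)

variable {d : Derivation ℤ Γ(Z, V) M} {d' : Derivation ℤ Γ(Z, V') M'}
    (hd : derivationPoint hV d ≫ f = derivationPoint hV (0 : Derivation ℤ Γ(Z, V) M) ≫ f)
    (hd' : derivationPoint hV' d' ≫ f =
      derivationPoint hV' (0 : Derivation ℤ Γ(Z, V') M') ≫ f)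

/-- Differences commute with base change, and so do their coordinates. Taking `g'` with an equation
instead of the composite `h ≫ g` avoids transports in the applications. -/
lemma sum_appTop_smul_pullSec {S S' : Scheme.{u}} (τ : Torsor W p) (h : S' ⟶ S) {g : S ⟶ Y}
    {g' : S' ⟶ Y} (hg : h ≫ g = g')
    {t₁ t₂ : {t : S ⟶ T // t ≫ p = g}} {t₁' t₂' : {t : S' ⟶ T // t ≫ p = g'}}
    (h₁ : h ≫ t₁.1 = t₁'.1) (h₂ : h ≫ t₂.1 = t₂'.1)
    {n : ℕ} {e : Fin n → Γ(W, U)} (hU : ⊤ ≤ g ⁻¹ᵁ U) (hU' : ⊤ ≤ g' ⁻¹ᵁ U) (c : Fin n → Γ(S, ⊤))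
    (hc : ∑ j, c j • pullSec g W hU (e j) = τ.diff g t₁ t₂) :
    ∑ j, h.appTop (c j) • pullSec g' W hU' (e j) = τ.diff g' t₁' t₂' := by
  subst hg
  have := congr(pullbackSection h g W $hc)
  rw [τ.pullbackSection_diff, map_sum] at this
  simp only [pullbackSection_smul, pullbackSection_pullSec g W h hU hU'] at this
  rw [this]
  congr 1
  · exact Subtype.ext h₁
  · exact Subtype.ext h₂

/-- Modulo `M` both points become `hV.fromSpec ≫ i`, whose difference with itself is zero; the
coordinates thus lie in `M`. -/
lemma fst_diffCoord (j : Fin n) : SqZeroExt.fst (diffCoord hV τ hf he hVU hd j) = 0 := by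
  have hU : ⊤ ≤ (hV.fromSpec ≫ f) ⁻¹ᵁ U := fun x _ ↦ hVU (hV.range_fromSpec.subset ⟨_, rfl⟩)
  have h0 := fst_comp_derivationPoint hV (0 : Derivation ℤ Γ(Z, V) M)
  have h1 := sum_appTop_smul_pullSec τ (Spec.map (CommRingCat.ofHom SqZeroExt.fst))
    (by rw [← Category.assoc, h0])
    (t₁' := ⟨hV.fromSpec ≫ i, by rw [Category.assoc, hf]⟩)
    (t₂' := ⟨hV.fromSpec ≫ i, by rw [Category.assoc, hf]⟩)
    (by rw [← Category.assoc, h0]) (by rw [← Category.assoc, fst_comp_derivationPoint])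
    _ hU _ ((he _ _ ⊤ (le_derivationPoint_comp_preimage hV hVU 0)).sum_coord
      (derivationDiff hV τ hf hd))
  rw [τ.diff_self] at h1
  have h2 := congr_fun ((he _ _ _ hU).coord_eq h1) j
  rw [IsBasis.coord_zero] at h2
  have h3 := congr($(Scheme.ΓSpecIso_naturality (CommRingCat.ofHom
    (SqZeroExt.fst (B := Γ(Z, V)) (M := M))))
    ((he _ _ ⊤ (le_derivationPoint_comp_preimage hV hVU 0)).coord (derivationDiff hV τ hf hd) j))
  exact h3.symm.trans (congr((Scheme.ΓSpecIso _).hom $h2.symm).trans (map_zero _))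

lemma diffCoord_restrict (h : V' ≤ V) (m : M →+ M')
    (hm : ∀ b x, m (b • x) = (Z.presheaf.map (homOfLE h).op).hom b • m x)
    (hmd : ∀ b, m (d b) = d' ((Z.presheaf.map (homOfLE h).op).hom b)) (j : Fin n) :
    SqZeroExt.map _ m hm (diffCoord hV τ hf he hVU hd j) =
      diffCoord hV' τ hf he (h.trans hVU) hd' j := by
  have h0 := sqZeroRestrict_comp hV hV' h m hm 0 0 (by simp)
  have h1 := sum_appTop_smul_pullSec τ (sqZeroRestrict h m hm)
    (by rw [← Category.assoc, h0])
    (t₁' := ⟨derivationPoint hV' 0 ≫ i, by rw [Category.assoc, hf]⟩)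
    (t₂' := ⟨derivationPoint hV' d' ≫ i, by rw [Category.assoc, hf, hd']⟩)
    (by rw [← Category.assoc, h0])
    (by rw [← Category.assoc, sqZeroRestrict_comp hV hV' h m hm d d' hmd])
    _ (le_derivationPoint_comp_preimage hV' (h.trans hVU) 0) _
    ((he _ _ ⊤ (le_derivationPoint_comp_preimage hV hVU 0)).sum_coord
      (derivationDiff hV τ hf hd))
  have h2 := congr_fun ((he _ _ _ _).coord_eq h1) j
  have h3 := congr($(Scheme.ΓSpecIso_naturality (CommRingCat.ofHom (SqZeroExt.map _ m hm)))
    ((he _ _ ⊤ (le_derivationPoint_comp_preimage hV hVU 0)).coord (derivationDiff hV τ hf hd) j))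
  exact h3.symm.trans congr((Scheme.ΓSpecIso _).hom $h2.symm)

/-- If all coordinates vanish, the two points of `T` agree, hence so do those of `Z` because `i` is
a monomorphism. -/
lemma eq_zero_of_snd_diffCoord [Mono i]
    (h : ∀ j, SqZeroExt.snd (diffCoord hV τ hf he hVU hd j) = 0) : d = 0 := by
  have h1 : derivationDiff hV τ hf hd = 0 := by
    rw [← (he _ _ ⊤ (le_derivationPoint_comp_preimage hV hVU 0)).sum_coord
      (derivationDiff hV τ hf hd)]
    refine Finset.sum_eq_zero fun j _ ↦ ?_
    have h2 : diffCoord hV τ hf he hVU hd j = 0 :=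
      SqZeroExt.ext (fst_diffCoord hV τ hf he hVU hd j) (h j)
    have h3 := (map_eq_zero_iff _ (ConcreteCategory.bijective_of_isIso
      (Scheme.ΓSpecIso (.of (SqZeroExt Γ(Z, V) M))).hom).1).mp h2
    rw [h3, zero_smul]
  have h4 := congr_arg Subtype.val (τ.eq_of_diff_eq_zero _ h1)
  rw [cancel_mono] at h4
  exact (derivationPoint_injective hV h4).symm

lemma ΓSpecIso_appLE_derivationPoint (hk : ⊤ ≤ (derivationPoint hV d) ⁻¹ᵁ V) (b : Γ(Z, V)) :
    (Scheme.ΓSpecIso (.of (SqZeroExt Γ(Z, V) M))).hom.hom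
      ((derivationPoint hV d).appLE V ⊤ hk b) = SqZeroExt.ofDerivation d b := by
  have h1 : (derivationPoint hV d).appLE V ⊤ hk ≫
      (Scheme.ΓSpecIso (.of (SqZeroExt Γ(Z, V) M))).hom =
        CommRingCat.ofHom (SqZeroExt.ofDerivation d) := by
    simp only [derivationPoint, Scheme.Hom.comp_appLE, IsAffineOpen.fromSpec_app_self,
      Category.assoc]
    rw [Iso.inv_comp_eq, ← Scheme.ΓSpecIso_naturality, Scheme.Hom.appTop, Scheme.Hom.app_eq_appLE]
    rfl
  exact congr($h1 b)

/-- The transition matrix is pulled back along the point of the zero derivation, so its entries have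
no `M`-component and the coordinates change linearly over `Γ(Z, V)`. -/
lemma snd_diffCoord_of_change {U' : Y.Opens} {n' : ℕ} {e' : Fin n' → Γ(W, U')} (he' : IsFrame e')
    (hVU' : V ≤ f ⁻¹ᵁ U') (a : Fin n' → Fin n → Γ(Z, V))
    (ha : ∀ k, ∑ j, a k j • pullSec f W hVU (e j) = pullSec f W hVU' (e' k)) (j : Fin n) :
    SqZeroExt.snd (diffCoord hV τ hf he hVU hd j) =
      ∑ k, a k j • SqZeroExt.snd (diffCoord hV τ hf he' hVU' hd k) := by
  let k := derivationPoint hV (0 : Derivation ℤ Γ(Z, V) M)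
  have hk : ⊤ ≤ k ⁻¹ᵁ V := fun x _ ↦ hV.range_fromSpec.subset ⟨_, rfl⟩
  have h1 (l) : ∑ j, k.appLE V ⊤ hk (a l j) • pullSec (k ≫ f) W
      (le_derivationPoint_comp_preimage hV hVU 0) (e j) =
        pullSec (k ≫ f) W (le_derivationPoint_comp_preimage hV hVU' 0) (e' l) := by
    have := congr(((Scheme.Modules.pullbackComp k f).hom.app W).app ⊤ (pullSec k _ hk $(ha l)))
    rw [pullbackComp_pullSec, map_sum, map_sum] at this
    rw [← this]
    refine Finset.sum_congr rfl fun j _ ↦ ?_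
    rw [pullSec_smul]
    refine Eq.trans ?_ (Scheme.Modules.Hom.app_smul _ _ _).symm
    rw [pullbackComp_pullSec]
  have h2 := (he' _ _ ⊤ (le_derivationPoint_comp_preimage hV hVU' 0)).sum_coord
      (derivationDiff hV τ hf hd)
  have h3 := (he _ _ ⊤ (le_derivationPoint_comp_preimage hV hVU 0)).coord_eq
    (x := derivationDiff hV τ hf hd)
    (c := fun j ↦ ∑ l, (he' _ _ ⊤ (le_derivationPoint_comp_preimage hV hVU' 0)).coord
      (derivationDiff hV τ hf hd) l * k.appLE V ⊤ hk (a l j)) (by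
    simp only [Finset.sum_smul, mul_smul]
    rw [Finset.sum_comm]
    simp only [← Finset.smul_sum]
    exact (Finset.sum_congr rfl fun l _ ↦ by rw [h1]).trans h2)
  have h4 := congr((Scheme.ΓSpecIso (.of (SqZeroExt Γ(Z, V) M))).hom.hom $(congr_fun h3 j))
  rw [map_sum] at h4
  refine congr(SqZeroExt.snd $h4).trans ?_
  rw [map_sum]
  refine Finset.sum_congr rfl fun l _ ↦ ?_
  rw [map_mul, SqZeroExt.snd_mul]
  have h5 := ΓSpecIso_appLE_derivationPoint hV (M := M) hk (a l j)
  refine (congr(_ • SqZeroExt.snd $h5 + SqZeroExt.fst $h5 • _)).trans ?_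
  rw [SqZeroExt.snd_ofDerivation, SqZeroExt.fst_ofDerivation, Derivation.zero_apply, smul_zero,
    zero_add]
  rfl
end

/-! ### Sections of associated sheaves and of tensor products. -/

lemma eq_zero_of_sum_tmul {R M N : Type*} [CommRing R] [AddCommGroup M] [Module R M]
    [AddCommGroup N] [Module R N] {n : ℕ} {e : Fin n → N}
    (he : Function.Bijective fun c : Fin n → R ↦ ∑ i, c i • e i) {m : Fin n → M}
    (h : ∑ j, TensorProduct.tmul R (m j) (e j) = 0) (j : Fin n) : m j = 0 := by
  let b : Module.Basis (Fin n) R N := .ofEquivFun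
    (LinearEquiv.ofBijective (Fintype.linearCombination R e) he).symm
  have hb (j) : b j = e j := by
    simp only [b, Module.Basis.coe_ofEquivFun, LinearEquiv.symm_symm]
    refine (Fintype.linearCombination_apply_single R e j 1).trans (one_smul _ _)
  have h1 := TensorProduct.sum_tmul_basis_right_eq_zero b (Finsupp.equivFunOnFinite.symm m)
    (by simpa [Finsupp.sum_fintype, hb] using h)
  simpa using congr($h1 j)

section Sheafify

open Opposite

variable {Z : Scheme.{u}} (P : Z.PresheafOfModules) {V V' V'' : Z.Opens}

instance : Module Γ(Z, V) (P.obj (op V)) :=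
  inferInstanceAs (Module (Z.ringCatSheaf.obj.obj (op V)) (P.obj (op V)))

/-- The restriction maps of a presheaf of modules. -/
def restr (h : V' ≤ V) : P.obj (op V) →+ P.obj (op V') :=
  (P.presheaf.map (homOfLE h).op).hom

lemma restr_smul (h : V' ≤ V) (r : Γ(Z, V)) (x : P.obj (op V)) :
    restr P h (r • x) = Z.presheaf.map (homOfLE h).op r • restr P h x :=
  P.map_smul _ _ _

lemma restr_restr (h : V' ≤ V) (h' : V'' ≤ V') (x : P.obj (op V)) :
    restr P h' (restr P h x) = restr P (h'.trans h) x :=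
  congr($(P.presheaf.map_comp (homOfLE h).op (homOfLE h').op) x).symm

/-- The map from the sections of a presheaf of modules to those of its associated sheaf. -/
def toSheafify (V : Z.Opens) : P.obj (op V) →ₗ[Γ(Z, V)] Γ(sheafify P, V) where
  toFun x := ((CategoryTheory.toSheafify (Opens.grothendieckTopology Z) P.presheaf).app (op V)).hom x
  map_add' := map_add _
  map_smul' r x := (((PresheafOfModules.sheafificationAdjunction (𝟙 Z.ringCatSheaf.obj)).unit.app
    P).app (op V)).hom.map_smul r x

lemma map_toSheafify (h : V' ≤ V) (x : P.obj (op V)) :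
    (sheafify P).presheaf.map (homOfLE h).op (toSheafify P V x) =
      toSheafify P V' (restr P h x) :=
  congr($((CategoryTheory.toSheafify (Opens.grothendieckTopology Z) P.presheaf).naturality
    (homOfLE h).op) x).symm

/-- Sheafification kills only what is locally zero. -/
lemma exists_restr_eq_zero {x : P.obj (op V)} (hx : toSheafify P V x = 0) {z : Z} (hz : z ∈ V) :
    ∃ (V' : Z.Opens) (_ : z ∈ V') (h : V' ≤ V), restr P h x = 0 := by
  have h1 := Presheaf.equalizerSieve_mem (Opens.grothendieckTopology Z)
    (CategoryTheory.toSheafify (Opens.grothendieckTopology Z) P.presheaf) (X := op V)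
    x (0 : P.presheaf.obj (op V)) (hx.trans (map_zero (toSheafify P V)).symm)
  obtain ⟨V', i, hi, hzV'⟩ := h1 z hz
  exact ⟨V', hzV', leOfHom i, Eq.trans hi (map_zero _)⟩

variable (M N : Z.Modules)

/-- The tensor product of sections. -/
def tmul (V : Z.Opens) : Γ(M, V) →ₗ[Γ(Z, V)] Γ(N, V) →ₗ[Γ(Z, V)] Γ(tensor M N, V) :=
  (TensorProduct.mk Γ(Z, V) (M.val.obj (op V)) (N.val.obj (op V))).compr₂
    (toSheafify (PresheafOfModules.Monoidal.tensorObj (R := Z.presheaf) M.val N.val) V)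

lemma map_tmul (h : V' ≤ V) (m : Γ(M, V)) (n : Γ(N, V)) :
    (tensor M N).presheaf.map (homOfLE h).op (tmul M N V m n) =
      tmul M N V' (M.presheaf.map (homOfLE h).op m) (N.presheaf.map (homOfLE h).op n) :=
  map_toSheafify _ h _

/-- Locally the relation already holds in the presheaf tensor product, where coefficients with
respect to a basis are unique. -/
lemma exists_map_eq_zero_of_sum_tmul {n : ℕ} {e : Fin n → Γ(N, V)}
    (he : ∀ (V' : Z.Opens) (h : V' ≤ V), IsBasis fun j ↦ N.presheaf.map (homOfLE h).op (e j))
    {m : Fin n → Γ(M, V)} (hm : ∑ j, tmul M N V (m j) (e j) = 0) {z : Z} (hz : z ∈ V) :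
    ∃ (V' : Z.Opens) (_ : z ∈ V') (h : V' ≤ V), ∀ j, M.presheaf.map (homOfLE h).op (m j) = 0 := by
  have h1 : toSheafify (PresheafOfModules.Monoidal.tensorObj (R := Z.presheaf) M.val N.val) V
      (∑ j, TensorProduct.tmul Γ(Z, V) (M := M.val.obj (op V)) (N := N.val.obj (op V)) (m j) (e j))
      = 0 := (map_sum _ _ _).trans hm
  obtain ⟨V', hz', h, h2⟩ := exists_restr_eq_zero _ h1 hz
  refine ⟨V', hz', h, ?_⟩
  exact eq_zero_of_sum_tmul (R := Γ(Z, V')) (N := Γ(N, V')) (he V' h)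
    ((map_sum (restr (PresheafOfModules.Monoidal.tensorObj (R := Z.presheaf) M.val N.val) h)
      _ _).symm.trans h2)

end Sheafify

/-! ### Differentials, and ramification at the generic point. -/

lemma formallyUnramified_of_derivation {B K L : Type u} [CommRing B] [CommRing K] [CommRing L]
    (φ : K →+* L) [Algebra B L] [IsDomain B] [IsFractionRing B L]
    (h : ∀ (N : Type u) [AddCommGroup N] [Module B N] (D : Derivation ℤ B N),
      (∀ b a, algebraMap B L b = φ a → D b = 0) → D = 0) : φ.FormallyUnramified := by
  let := φ.toAlgebra
  refine (Algebra.formallyUnramified_iff K L).mpr ?_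
  let : Module B Ω[L⁄K] := Module.compHom _ (algebraMap B L)
  let D : Derivation ℤ B Ω[L⁄K] := Derivation.mk'
    ((KaehlerDifferential.D K L).toLinearMap.toAddMonoidHom.comp
      (algebraMap B L).toAddMonoidHom).toIntLinearMap fun a b ↦ by
        simp
        rfl
  have hD : D = 0 := h _ D fun b a hab ↦ by
    change KaehlerDifferential.D K L (algebraMap B L b) = 0
    rw [hab]
    exact (KaehlerDifferential.D K L).map_algebraMap a
  have hB (b : B) : KaehlerDifferential.D K L (algebraMap B L b) = 0 := congr($hD b)
  rw [← Submodule.subsingleton_iff L, ← subsingleton_iff_bot_eq_top,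
    ← KaehlerDifferential.span_range_derivation, eq_comm, Submodule.span_eq_bot]
  rintro _ ⟨x, rfl⟩
  -- Quotient rule: `s • d(b/s) = 0` because `db = ds = 0`, and `s` is invertible in `L`.
  obtain ⟨b, s, rfl⟩ := IsLocalization.exists_mk'_eq (nonZeroDivisors B) x
  have h1 := congr(KaehlerDifferential.D K L $(IsLocalization.mk'_spec L b s))
  rw [Derivation.leibniz, hB, hB, smul_zero, zero_add] at h1
  exact (IsLocalization.map_units L s).smul_eq_zero.mp h1

section PresheafDifferentials

open Opposite TopCat.Presheaf

variable {Y Z : Scheme.{u}} (f : Z ⟶ Y) {V V' : Z.Opens} {U : Y.Opens}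

lemma unit_inverseImageToStructure (h : V ≤ f ⁻¹ᵁ U) :
    ((pullbackPushforwardAdjunction CommRingCat.{u} f.base).unit.app Y.presheaf).app (op U) ≫
      ((pullback CommRingCat.{u} f.base).obj Y.presheaf).map (homOfLE h).op ≫
        (inverseImageToStructure f).app (op V) = f.appLE U V h := by
  have h1 := (pullbackPushforwardAdjunction CommRingCat.{u} f.base).homEquiv_unit
    (f := inverseImageToStructure f)
  rw [inverseImageToStructure, Equiv.apply_symm_apply] at h1
  have h2 := congr(($h1).app (op U))
  rw [(inverseImageToStructure f).naturality]
  exact (congr($h2.symm ≫ Z.presheaf.map (homOfLE h).op))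

/-- Shows that sections of the presheaf inverse image land, in the stalk at `z`, in the image of the
local ring of `Y` at `f z`. -/
lemma inverseImageToStructure_germ {z : Z} (hz : z ∈ V) :
    (inverseImageToStructure f).app (op V) ≫ Z.presheaf.germ V z hz =
      germToPullbackStalk CommRingCat.{u} f.base Y.presheaf V z hz ≫ f.stalkMap z := by
  refine pullback_obj_obj_ext _ fun U hU ↦ ?_
  have h1 := congr($(unit_inverseImageToStructure f hU) ≫ Z.presheaf.germ V z hz)
  have h2 := congr($(pullbackPushforwardAdjunction_unit_pullback_map_germToPullbackStalk
    CommRingCat.{u} f.base Y.presheaf V z hz U hU) ≫ f.stalkMap z)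
  simp only [Category.assoc] at h1 h2
  refine h1.trans (Eq.trans ?_ h2.symm)
  rw [Scheme.Hom.appLE, Category.assoc, Z.presheaf.germ_res]
  exact (f.germ_stalkMap U z (hU hz)).symm

/-- The presheaf of relative differentials. -/
abbrev presheafDifferentials : Z.PresheafOfModules :=
  PresheafOfModules.DifferentialsConstruction.relativeDifferentials' (inverseImageToStructure f)

/-- The universal derivation of the presheaf of relative differentials. -/
def presheafD (V : Z.Opens) :
    Derivation ℤ Γ(Z, V) ((presheafDifferentials f).obj (op V)) :=
  let D := PresheafOfModules.DifferentialsConstruction.derivation' (inverseImageToStructure f)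
  Derivation.mk' (D.d (X := op V)).toIntLinearMap fun a b ↦ D.d_mul a b

lemma restr_presheafD (h : V' ≤ V) (b : Γ(Z, V)) :
    restr (presheafDifferentials f) h (presheafD f V b) =
      presheafD f V' (Z.presheaf.map (homOfLE h).op b) :=
  ((PresheafOfModules.DifferentialsConstruction.derivation' (inverseImageToStructure f)).d_map
    (homOfLE h).op b).symm

lemma presheafD_inverseImageToStructure
    (a : ((pullback CommRingCat.{u} f.base).obj Y.presheaf).obj (op V)) :
    presheafD f V ((inverseImageToStructure f).app (op V) a) = 0 :=
  (PresheafOfModules.DifferentialsConstruction.derivation' (inverseImageToStructure f)).d_app a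

lemma presheafD_appLE (h : V ≤ f ⁻¹ᵁ U) (r : Γ(Y, U)) : presheafD f V (f.appLE U V h r) = 0 := by
  rw [← unit_inverseImageToStructure f h]
  exact presheafD_inverseImageToStructure f _

lemma derivation_eq_zero_of_presheafD_eq_zero (hV : presheafD f V = 0) {N : Type u}
    [AddCommGroup N] [Module Γ(Z, V) N] (D : Derivation ℤ Γ(Z, V) N)
    (hD : ∀ a, D ((inverseImageToStructure f).app (op V) a) = 0) : D = 0 := by
  let D' : (ModuleCat.of Γ(Z, V) N).Derivation ((inverseImageToStructure f).app (op V)) :=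
    ModuleCat.Derivation.mk (fun b ↦ D b) (fun _ _ ↦ map_add D _ _) (fun _ _ ↦ D.leibniz _ _) hD
  ext b
  have h1 := D'.desc_d b
  have h2 : CommRingCat.KaehlerDifferential.d (f := (inverseImageToStructure f).app (op V)) b = 0 :=
    congr($hV b)
  rw [h2, map_zero] at h1
  exact h1.symm

/-- A derivation of `Γ(Z, V)` killing what comes from the stalk of `Y` also kills the image of the
presheaf inverse image, so it factors through the universal derivation, which is zero. -/
lemma formallyUnramified_stalkMap [IsIntegral Z] (hV : IsAffineOpen V)
    (hη : genericPoint Z ∈ V) (hd : presheafD f V = 0) :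
    (f.stalkMap (genericPoint Z)).hom.FormallyUnramified := by
  have : Nonempty V := ⟨⟨_, hη⟩⟩
  have hfrac := functionField_isFractionRing_of_isAffineOpen Z V hV
  refine formallyUnramified_of_derivation (f.stalkMap (genericPoint Z)).hom
    (B := Γ(Z, V)) (L := Z.functionField) fun N _ _ D hD ↦ ?_
  refine derivation_eq_zero_of_presheafD_eq_zero f hd D fun a ↦ ?_
  have h1 := congr($(inverseImageToStructure_germ f hη) a)
  exact hD _ _ h1

end PresheafDifferentials

/-! ### The difference of the two points as a local section of `Ω_f ⊗ f^*W`. -/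

section LocalSection

open Opposite

variable {Y T Z : Scheme.{u}} {f : Z ⟶ Y} {V V' : Z.Opens} (hV : IsAffineOpen V)
  (hV' : IsAffineOpen V') {W : Y.Modules} {p : T ⟶ Y} (τ : Torsor W p) {i : Z ⟶ T}
  (hf : i ≫ p = f) {U U' : Y.Opens} (hU : IsAffineOpen U) (hU' : IsAffineOpen U')
  {n n' : ℕ} {e : Fin n → Γ(W, U)} (he : IsFrame e) {e' : Fin n' → Γ(W, U')} (he' : IsFrame e')
  (hVU : V ≤ f ⁻¹ᵁ U) (hVU' : V ≤ f ⁻¹ᵁ U')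

lemma derivationPoint_presheafD_comp (hV : IsAffineOpen V) (hU : IsAffineOpen U)
    (hVU : V ≤ f ⁻¹ᵁ U) : derivationPoint hV (presheafD f V) ≫ f =
    derivationPoint hV (0 : Derivation ℤ Γ(Z, V) ((presheafDifferentials f).obj (op V))) ≫ f :=
  derivationPoint_comp hV hU hVU _ (presheafD_appLE f hVU)

/-- The coefficients of the first order deviation of `i` with respect to a frame. -/
def localCoeff (j : Fin n) : (presheafDifferentials f).obj (op V) :=
  SqZeroExt.snd (diffCoord hV τ hf he hVU (derivationPoint_presheafD_comp hV hU hVU) j)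

lemma restr_localCoeff (h : V' ≤ V) (j : Fin n) :
    restr (presheafDifferentials f) h (localCoeff hV τ hf hU he hVU j) =
      localCoeff hV' τ hf hU he (h.trans hVU) j :=
  congr(SqZeroExt.snd $(diffCoord_restrict hV hV' τ hf he hVU
    (derivationPoint_presheafD_comp hV hU hVU)
    (derivationPoint_presheafD_comp hV' hU (h.trans hVU)) h
    (restr (presheafDifferentials f) h) (restr_smul _ h) (restr_presheafD f h) j))

/-- The images of the coefficients in the sheaf of differentials. -/
def localSheafCoeff (j : Fin n) : Γ(differentials f, V) :=
  toSheafify (presheafDifferentials f) V (localCoeff hV τ hf hU he hVU j)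

lemma map_localSheafCoeff (h : V' ≤ V) (j : Fin n) :
    (differentials f).presheaf.map (homOfLE h).op (localSheafCoeff hV τ hf hU he hVU j) =
      localSheafCoeff hV' τ hf hU he (h.trans hVU) j :=
  (map_toSheafify _ h _).trans
    congr(toSheafify (presheafDifferentials f) V' $(restr_localCoeff hV hV' τ hf hU he hVU h j))

lemma localSheafCoeff_of_change (a : Fin n' → Fin n → Γ(Z, V))
    (ha : ∀ k, ∑ j, a k j • pullSec f W hVU (e j) = pullSec f W hVU' (e' k)) (j : Fin n) :
    localSheafCoeff hV τ hf hU he hVU j =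
      ∑ k, a k j • localSheafCoeff hV τ hf hU' he' hVU' k := by
  have h1 : localCoeff hV τ hf hU he hVU j = ∑ k, a k j • localCoeff hV τ hf hU' he' hVU' k :=
    snd_diffCoord_of_change hV τ hf he hVU _ he' hVU' a ha j
  refine congr(toSheafify (presheafDifferentials f) V $h1).trans ?_
  exact (map_sum (toSheafify (presheafDifferentials f) V) _ _).trans
    (Finset.sum_congr rfl fun k _ ↦ (toSheafify (presheafDifferentials f) V).map_smul _ _)

/-- The first order deviation of `i`, as a local section of `Ω ⊗ f^* W`. -/
def localSection : Γ(tensor (differentials f) ((Scheme.Modules.pullback f).obj W), V) :=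
  ∑ j, tmul (differentials f) ((Scheme.Modules.pullback f).obj W) V
    (localSheafCoeff hV τ hf hU he hVU j) (pullSec f W hVU (e j))

lemma map_localSection (h : V' ≤ V) :
    (tensor (differentials f) ((Scheme.Modules.pullback f).obj W)).presheaf.map (homOfLE h).op
      (localSection hV τ hf hU he hVU) = localSection hV' τ hf hU he (h.trans hVU) := by
  rw [localSection, map_sum]
  refine Finset.sum_congr rfl fun j _ ↦ ?_
  rw [map_tmul, map_pullSec, map_localSheafCoeff hV hV']

/-- The transition matrix between the two frames moves across the tensor sign. -/
lemma localSection_eq :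
    localSection hV τ hf hU he hVU = localSection hV τ hf hU' he' hVU' := by
  choose a ha using fun k ↦ (he Z f V hVU).2 (pullSec f W hVU' (e' k))
  rw [localSection, localSection]
  simp only [localSheafCoeff_of_change hV τ hf hU hU' he he' hVU hVU' a ha, ← ha, map_sum, map_smul,
    LinearMap.sum_apply, LinearMap.smul_apply]
  rw [Finset.sum_comm]

lemma presheafD_eq_zero_of_localCoeff [Mono i] (hV : IsAffineOpen V) (τ : Torsor W p)
    (hf : i ≫ p = f) (hU : IsAffineOpen U) (he : IsFrame e) (hVU : V ≤ f ⁻¹ᵁ U)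
    (h : ∀ j, localCoeff hV τ hf hU he hVU j = 0) :
    presheafD f V = 0 :=
  eq_zero_of_snd_diffCoord hV τ hf he hVU _ h

end LocalSection

/-! ### Gluing the local sections. -/

section Global

open Opposite

variable {Y T Z : Scheme.{u}} {f : Z ⟶ Y} {W : Y.Modules}
  {p : T ⟶ Y} (τ : Torsor W p) {i : Z ⟶ T} (hf : i ≫ p = f)

lemma exists_affine_frame (f : Z ⟶ Y) (hW : IsVectorBundle W) (z : Z) (V : Z.Opens) (hz : z ∈ V) :
    ∃ (V' : Z.Opens) (_ : z ∈ V') (_ : V' ≤ V) (_ : IsAffineOpen V') (U : Y.Opens)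
      (_ : V' ≤ f ⁻¹ᵁ U) (n : ℕ) (e : Fin n → Γ(W, U)), IsAffineOpen U ∧ IsFrame e := by
  obtain ⟨U, hU, n, e, hU', he⟩ := hW.exists_isFrame (f z)
  obtain ⟨_, ⟨V', hV', rfl⟩, hzV', hVV' : V' ≤ V ⊓ f ⁻¹ᵁ U⟩ :=
    Z.isBasis_affineOpens.exists_subset_of_mem_open (show z ∈ V ⊓ f ⁻¹ᵁ U from ⟨hz, hU⟩)
      (V ⊓ f ⁻¹ᵁ U).2
  exact ⟨V', hzV', hVV'.trans inf_le_left, hV', U, hVV'.trans inf_le_right, n, e, hU', he⟩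

lemma eq_of_cover {M : Z.Modules} {V : Z.Opens} {s t : Γ(M, V)}
    (h : ∀ z ∈ V, ∃ (V' : Z.Opens) (_ : z ∈ V') (h : V' ≤ V),
      M.presheaf.map (homOfLE h).op s = M.presheaf.map (homOfLE h).op t) : s = t := by
  choose! V' hz hV' hst using h
  refine TopCat.Sheaf.eq_of_locally_eq' (⟨M.presheaf, M.isSheaf⟩ : TopCat.Sheaf Ab.{u} Z)
    (fun z : V ↦ V' z) V (fun z ↦ homOfLE (hV' z z.2)) (fun z hzV ↦ ?_) _ _ fun z ↦ hst z z.2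
  exact TopologicalSpace.Opens.mem_iSup.mpr ⟨⟨z, hzV⟩, hz z hzV⟩

lemma map_map {M : Z.Modules} {V V' V'' : Z.Opens} (h : V' ≤ V) (h' : V'' ≤ V') (s : Γ(M, V)) :
    M.presheaf.map (homOfLE h').op (M.presheaf.map (homOfLE h).op s) =
      M.presheaf.map (homOfLE (h'.trans h)).op s :=
  congr($(M.presheaf.map_comp (homOfLE h).op (homOfLE h').op) s).symm

lemma exists_globalSection (hW : IsVectorBundle W) :
    ∃ s : Γ(tensor (differentials f) ((Scheme.Modules.pullback f).obj W), ⊤),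
      ∀ (V : Z.Opens) (hV : IsAffineOpen V) (U : Y.Opens) (hU : IsAffineOpen U)
        (hVU : V ≤ f ⁻¹ᵁ U) (n : ℕ) (e : Fin n → Γ(W, U)) (he : IsFrame e),
        (tensor (differentials f) ((Scheme.Modules.pullback f).obj W)).presheaf.map
          (homOfLE le_top).op s = localSection hV τ hf hU he hVU := by
  -- Indexing by all pairs of an open and a point in it makes one family cover `Z` and also every
  -- overlap on which the sections are compared.
  choose V hzV hVle hV U hVU n e hU he using fun (x : Σ V : Z.Opens, V) ↦
    exists_affine_frame f hW x.2.1 x.1 x.2.2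
  let M := tensor (differentials f) ((Scheme.Modules.pullback f).obj W)
  obtain ⟨s, hs, -⟩ := TopCat.Sheaf.existsUnique_gluing'
    (⟨M.presheaf, M.isSheaf⟩ : TopCat.Sheaf Ab.{u} Z) V ⊤ (fun x ↦ homOfLE le_top)
    (fun z _ ↦ TopologicalSpace.Opens.mem_iSup.mpr ⟨⟨⊤, z, trivial⟩, hzV _⟩)
    (fun x ↦ localSection (hV x) τ hf (hU x) (he x) (hVU x)) fun x y ↦ by
      refine eq_of_cover fun z hz ↦ ⟨V ⟨_, z, hz⟩, hzV _, hVle _, ?_⟩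
      refine (map_map _ _ _).trans (Eq.trans ?_ (map_map _ _ _).symm)
      rw [map_localSection _ (hV _), map_localSection _ (hV _)]
      exact localSection_eq _ _ _ _ _ _ _ _ _
  refine ⟨s, fun V' hV' U' hU' hVU' n' e' he' ↦ ?_⟩
  refine eq_of_cover fun z hz ↦ ⟨V ⟨_, z, hz⟩, hzV _, hVle _, ?_⟩
  rw [map_map, map_localSection _ (hV _)]
  exact (hs _).trans (localSection_eq _ _ _ _ _ _ _ _ _)

end Global

/-! ### Vanishing of the universal derivation near the generic point. -/

section

open Opposite

variable {Y T Z : Scheme.{u}} {f : Z ⟶ Y} {W : Y.Modules} {p : T ⟶ Y} {i : Z ⟶ T}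

lemma exists_restr_eq_zero_of_finite {P : Z.PresheafOfModules} {V : Z.Opens} {n : ℕ}
    {x : Fin n → P.obj (op V)} (hx : ∀ j, toSheafify P V (x j) = 0) {z : Z} (hz : z ∈ V) :
    ∃ (V' : Z.Opens) (_ : z ∈ V') (h : V' ≤ V), ∀ j, restr P h (x j) = 0 := by
  choose V' hzV' hV' h using fun j ↦ exists_restr_eq_zero P (hx j) hz
  let V'' : Z.Opens := ⟨⋂ j, V' j, isOpen_iInter_of_finite fun j ↦ (V' j).2⟩
  have hV'' (j) : V'' ≤ V' j := Set.iInter_subset _ j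
  refine ⟨V ⊓ V'', ⟨hz, Set.mem_iInter.mpr hzV'⟩, inf_le_left, fun j ↦ ?_⟩
  rw [← restr_restr P (hV' j) (inf_le_right.trans (hV'' j)), h, map_zero]

lemma exists_presheafD_eq_zero [IsIntegral Z] (hW : IsVectorBundle W) (τ : Torsor W p)
    [Mono i] (hf : i ≫ p = f)
    (hΩ : genericGlobalSections
      (tensor (differentials f) ((Scheme.Modules.pullback f).obj W)) = ⊥) :
    ∃ V : Z.Opens, IsAffineOpen V ∧ genericPoint Z ∈ V ∧ presheafD f V = 0 := by
  obtain ⟨s, hs⟩ := exists_globalSection τ hf hW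
  let M := tensor (differentials f) ((Scheme.Modules.pullback f).obj W)
  have h1 : M.presheaf.germ ⊤ (genericPoint Z) trivial s = 0 := by
    rw [← AddSubgroup.mem_bot, ← hΩ]
    exact ⟨s, rfl⟩
  -- The neighbourhood shrinks three times: to kill the section of the tensor sheaf, then its
  -- coefficients in the sheaf of differentials, then the coefficients in the presheaf. Each time it
  -- is made affine again, since square-zero points are attached to affine opens.
  obtain ⟨V₁, hV₁, k, _, h2⟩ := M.presheaf.germ_eq (U := ⊤) (V := ⊤) (genericPoint Z) trivial
    trivial s 0
    (h1.trans (map_zero (M.presheaf.germ ⊤ (genericPoint Z) trivial).hom).symm)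
  have h3 : M.presheaf.map (homOfLE le_top).op s = (0 : Γ(M, V₁)) := h2.trans (map_zero _)
  obtain ⟨V₂, hzV₂, hV₂₁, hV₂, U, hVU, n, e, hU, he⟩ := exists_affine_frame f hW _ V₁ hV₁
  have h4 : localSection hV₂ τ hf hU he hVU = 0 := by
    rw [← hs V₂ hV₂ U hU hVU n e he, ← map_map le_top hV₂₁]
    exact (congr(M.presheaf.map (homOfLE hV₂₁).op $h3)).trans (map_zero _)
  obtain ⟨V₃, hzV₃, hV₃₂, h5⟩ := exists_map_eq_zero_of_sum_tmul _ _ (fun V' h ↦ by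
    simp only [map_pullSec]
    exact he _ _ _ _) h4 hzV₂
  obtain ⟨V₄, hzV₄, hV₄₃, hV₄, -⟩ := exists_affine_frame f hW _ V₃ hzV₃
  have h6 (j) : localSheafCoeff hV₄ τ hf hU he (hV₄₃.trans (hV₃₂.trans hVU)) j = 0 := by
    rw [← map_localSheafCoeff hV₂ hV₄ τ hf hU he hVU (hV₄₃.trans hV₃₂), ← map_map hV₃₂ hV₄₃, h5,
      map_zero]
  obtain ⟨V₅, hzV₅, hV₅₄, h7⟩ := exists_restr_eq_zero_of_finite h6 hzV₄
  obtain ⟨V₆, hzV₆, hV₆₅, hV₆, -⟩ := exists_affine_frame f hW _ V₅ hzV₅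
  refine ⟨V₆, hV₆, hzV₆, presheafD_eq_zero_of_localCoeff hV₆ τ hf hU he
    ((hV₆₅.trans hV₅₄).trans (hV₄₃.trans (hV₃₂.trans hVU))) fun j ↦ ?_⟩
  rw [← restr_localCoeff hV₄ hV₆ τ hf hU he (hV₄₃.trans (hV₃₂.trans hVU)) (hV₆₅.trans hV₅₄),
    ← restr_restr _ hV₅₄ hV₆₅, h7, map_zero]

end

end TorsorLemma

end

theorem lemma2p1 {Y T Z : Scheme.{u}} [IsIntegral Y] (hY : TorsorLemma.IsNormal Y)
    (W : Y.Modules) (hW : TorsorLemma.IsVectorBundle W)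
    (p : T ⟶ Y) (τ : TorsorLemma.Torsor W p)
    (i : Z ⟶ T) [IsClosedImmersion i] [IsIntegral Z]
    (f : Z ⟶ Y) (hf : f = i ≫ p)
    -- `f` is quasi-finite
    [LocallyOfFiniteType f] [QuasiCompact f] [LocallyQuasiFinite f]
    [IsSeparated f] [UniversallyInjective f] [IsDominant f]
    (hΩ : TorsorLemma.genericGlobalSections
      (TorsorLemma.tensor (TorsorLemma.differentials f) ((Scheme.Modules.pullback f).obj W)) = ⊥) :
    IsOpenImmersion f := by
  obtain ⟨V, hV, hη, hd⟩ := TorsorLemma.exists_presheafD_eq_zero hW τ hf.symm hΩ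
  exact TorsorLemma.isOpenImmersion_of_surjective_stalkMap hY f
    (TorsorLemma.surjective_stalkMap_of_formallyUnramified f
      (TorsorLemma.formallyUnramified_stalkMap f hV hη hd))
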